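/- Let $m\in(0,1)$, $\kappa\ge 1$, $\theta>0$ and $\gamma(x,t)=x-\theta t^{\kappa}$. For $f\in H^s(\mathbb R)$, where $\|f\|_{H^s}=\|(1-\Delta)^{s/2}f\|_{L^2}$, write $$e^{it(-\Delta)^{m/2}}f(y)=\frac1{2\pi}\lim_{N\to\infty}\int_{|\xi|\le N}e^{i(y\xi+t|\xi|^m)}\widehat f(\xi)\,d\xi ,\qquad \widehat f(\xi)=\int_{\mathbb R} e^{-ix\xi}f(x)\,dx,$$ at the points $(y,t)$ where this limit exists. Limits as $t\to0$ below are taken over those $t\neq0$ for which the real power $t^\kappa$ is defined ($t>0$, and also $t<0$ if $\kappa$ is an integer), and include the claim that $e^{it(-\Delta)^{m/2}}f(\gamma(x,t))$ exists for all such $t$ that are sufficiently close to $0$. (i) If $s>\frac12-\frac m4$, then for every $f\in H^s(\mathbb R)$ $$\lim_{t\to0}e^{it(-\Delta)^{m/2}}f(\gamma(x,t))=f(x)\qquad\text{for almost every }x\in\mathbb R .$$ (ii) If $\frac12-\frac m4<s<\frac12$, then for every $f\in H^s(\mathbb R)$ the divergence set $\mathfrak D(f\circ\gamma)$ satisfies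 $$\dim_H\mathfrak D(f\circ\gamma)\le\frac{1-2s}{m}.$$ Here $\mathfrak D(f\circ\gamma)$ is the set of all $x\in\mathbb R$ for which it is not true that $f(x):=\frac1{2\pi}\lim_{N\to\infty}\int_{|\xi|\le N}e^{ix\xi}\widehat f(\xi)\,d\xi$ exists and $\lim_{t\to0}e^{it(-\Delta)^{m/2}}f(\gamma(x,t))=f(x)$. (iii) Let $\alpha\in(0,1]$, $2\le q<\infty$, $s>\max\{\frac12-\frac m4,\frac12-\frac{m\alpha}{q}\}$ and $A\ge0$. There is a constant $C=C(m,\kappa,\theta,\alpha,q,s,A)$ such that for every Borel measure $\mu$ supported in $[-1,1]$ with $\mu((x-r,x+r))\le A\,r^{\alpha}$ for all $x\in\mathbb R$, $r>0$, and every $f\in H^s(\mathbb R)$, the value $e^{it(-\Delta)^{m/2}}f(\gamma(x,t))$ exists for $\mu$-almost every $x$ and all $t\in(0,1)$, and $$\Big\|\,e^{it(-\Delta)^{m/2}}f(\gamma(x,t))\Big\|_{L^q_x(d\mu)L^\infty_t(0,1)}\le C\,\|f\|_{H^s(\mathbb R)} .$$ -/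

import Mathlib

open MeasureTheory Filter Topology Set
open scoped ENNReal NNReal FourierTransform SchwartzMap

noncomputable section

namespace FracSchrodinger

/-- The Fourier transform of `f ∈ L²(ℝ)` in the convention
`f̂(ξ) = ∫ e^{-i x ξ} f(x) dx`. Mathlib's `𝓕` uses `e^{-2π i x ξ}`, hence the rescaling. -/
def hat (f : Lp ℂ 2 (volume : Measure ℝ)) (ξ : ℝ) : ℂ :=
  (𝓕 f : Lp ℂ 2 (volume : Measure ℝ)) (ξ / (2 * Real.pi))

/-- `f ∈ H^s(ℝ)`, for `f ∈ L²(ℝ)`. -/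
def MemHs (s : ℝ) (f : Lp ℂ 2 (volume : Measure ℝ)) : Prop :=
  TemperedDistribution.MemSobolev s 2 (f : 𝓢'(ℝ, ℂ))

/-- The Sobolev norm `‖(1 - Δ)^{s/2} f‖_{L²} = ((2π)⁻¹ ∫ (1 + ξ²)^s |f̂(ξ)|² dξ)^{1/2}`. -/
def hsNorm (s : ℝ) (f : Lp ℂ 2 (volume : Measure ℝ)) : ℝ≥0∞ :=
  (ENNReal.ofReal (2 * Real.pi)⁻¹ *
    ∫⁻ ξ : ℝ, ENNReal.ofReal ((1 + ξ ^ 2) ^ s) * ‖hat f ξ‖ₑ ^ 2) ^ (1 / 2 : ℝ)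

/-- `(2π)⁻¹ ∫_{|ξ| ≤ N} e^{i (y ξ + t |ξ|^m)} f̂(ξ) dξ`; the integrand is integrable,
because `f̂` is square integrable. -/
def partialSol (m : ℝ) (f : Lp ℂ 2 (volume : Measure ℝ)) (N y t : ℝ) : ℂ :=
  ((2 * Real.pi)⁻¹ : ℝ) *
    ∫ ξ in Icc (-N) N, Complex.exp (Complex.I * ((y * ξ + t * |ξ| ^ m : ℝ) : ℂ)) * hat f ξ

/-- The integral that defines `e^{it(-Δ)^{m/2}} f (y)` converges. -/
def SolExists (m : ℝ) (f : Lp ℂ 2 (volume : Measure ℝ)) (y t : ℝ) : Prop :=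
  ∃ c : ℂ, Tendsto (fun N : ℝ => partialSol m f N y t) atTop (𝓝 c)

/-- The value `e^{it(-Δ)^{m/2}} f (y) = (2π)⁻¹ ∫ e^{i (y ξ + t |ξ|^m)} f̂(ξ) dξ`, as the limit of
the integrals over `|ξ| ≤ N`. Always used together with `SolExists m f y t`.
At `t = 0` it is the pointwise value `f(y)` given by Fourier inversion. -/
def sol (m : ℝ) (f : Lp ℂ 2 (volume : Measure ℝ)) (y t : ℝ) : ℂ :=
  limUnder atTop (fun N : ℝ => partialSol m f N y t)

/-- The curve `γ(x,t) = x - θ t^κ`. -/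
def curve (θ κ x t : ℝ) : ℝ := x - θ * t ^ κ

/-- The nonzero times at which the real power `t^κ` makes sense: all positive times, and also the
negative ones when `κ` is an integer. -/
def curveTimes (κ : ℝ) : Set ℝ :=
  {t | 0 < t ∨ (t < 0 ∧ ∃ k : ℕ, κ = k)}

/-- `e^{it(-Δ)^{m/2}} f (y) → c` as `(y,t) → (x,0)` with `y = γ(x,t)`. -/
def ConvergesAlong (m θ κ : ℝ) (f : Lp ℂ 2 (volume : Measure ℝ)) (x : ℝ) (c : ℂ) : Prop :=
  (∀ᶠ t in 𝓝[curveTimes κ] 0, SolExists m f (curve θ κ x t) t) ∧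
    Tendsto (fun t => sol m f (curve θ κ x t) t) (𝓝[curveTimes κ] 0) (𝓝 c)

/-- The divergence set `𝔇(f ∘ γ)`: the points at which convergence along the curve to the value
`f(x) = e^{i0(-Δ)^{m/2}} f (x)` fails (in particular, those where this value does not exist). -/
def divergenceSet (m θ κ : ℝ) (f : Lp ℂ 2 (volume : Measure ℝ)) : Set ℝ :=
  {x | ¬ (SolExists m f x 0 ∧ ConvergesAlong m θ κ f x (sol m f x 0))}

/-- `μ` is an `α`-dimensional measure supported in the unit ball, with
`sup_{x, r} μ(B(x,r)) / r^α ≤ A`. -/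
def IsAlphaDim (α : ℝ) (A : ℝ≥0) (μ : Measure ℝ) : Prop :=
  μ (Metric.closedBall 0 1)ᶜ = 0 ∧
    ∀ x r : ℝ, 0 < r → μ (Metric.ball x r) ≤ A * ENNReal.ofReal (r ^ α)

/-- `‖e^{it(-Δ)^{m/2}} f (γ(x,t))‖_{L^q_x(dμ) L^∞_t(0,1)}`. -/
def maximalNorm (m θ κ q : ℝ) (μ : Measure ℝ) (f : Lp ℂ 2 (volume : Measure ℝ)) : ℝ≥0∞ :=
  (∫⁻ x, (eLpNorm (fun t => sol m f (curve θ κ x t) t) ∞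
    (volume.restrict (Ioo (0 : ℝ) 1))) ^ q ∂μ) ^ (1 / q)

end FracSchrodinger

end

noncomputable section

namespace FracSchrodinger

/-! Everything is reduced to one dyadic block of frequencies at a time. Let `M_n(x)` (`blockSup`) be
the supremum, over `|t| ≤ 1` and cut-offs `N ∈ [2^n, 2^(n+1)]`, of the part of the solution along
the curve carried by `2^n < |ξ| ≤ N`. Because the cut-off is also varied, `∑ M_n(x) < ∞` settles the
point `x` at once: the truncated integrals converge as `N → ∞`, uniformly in `t`, so the solution
along the curve is continuous at `t = 0` (`solExists_zero_and_convergesAlong`). No approximation by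
smooth data is needed.

The block estimate is Kolmogorov–Seliverstov linearization followed by `TT*`
(`lintegral_sq_le_of_kernel`). The kernel integrates `e^{i(uξ + τ|ξ|^m)}` over `|ξ| ~ λ`, where `τ =
t(x) - t(y)` and, as `κ ≥ 1`, `|u - (x - y)| ≤ θκ|τ|`. Either `|τ|` is small against `|x - y|` and
the phase has no stationary point, or the second derivative of the phase is at least of order `|x -
y| λ^(m-2)`. Van der Corput gives `λ^(1-m/2) |x - y|^(-1/2)`, and interpolation with the trivial
bound `λ` gives `λ^(1-mb) |x - y|^(-b)` for `0 ≤ b ≤ 1/2`. Hence, for a finite measure `ν` whose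
potential `∫ |x - y|^(-b) dν(y)` is at most `V`, `∫ M_n² dν ≲ V 2^((1-mb-2s)n) ‖f‖²`
(`exists_lintegral_blockSup_sq_le`).

Three choices of `ν` give the three claims. Lebesgue measure on balls with `b = 1/2` gives (i); an
`L²` subsequence identifies the limit with `f`. For (iii), `dν = M_n^(q-2) dμ` and Hölder turn the
`L²` bound into an `L^q` bound, at the price `bq/2 < α`. For (ii), `ν` is a discrete Frostman
measure carried by small dyadic intervals meeting `{M_n > 2a}`; its mass bounds the `α`-cost of a
cover of that set (`exists_cover_blockSup`), and a divergence point lies in infinitely many such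
sets with `a` geometrically small. -/

/-! ### Van der Corput estimates -/

/-- Integrate by parts after writing `e^{iφ} = (-i/φ') (e^{iφ})'`. The boundary terms cost `2/δ`.
Since `φ''` has the constant sign `ε`, the modulus of the remaining integrand is, up to sign, the
derivative of `1/φ'`, so it integrates to at most another `2/δ`. -/
theorem norm_integral_exp_le_of_le_deriv {φ φ' φ'' : ℝ → ℝ} {a b δ ε : ℝ} (hab : a ≤ b)
    (hδ : 0 < δ) (h1 : ∀ x ∈ Icc a b, HasDerivAt φ (φ' x) x)
    (h2 : ∀ x ∈ Icc a b, HasDerivAt φ' (φ'' x) x) (hc : ContinuousOn φ'' (Icc a b))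
    (hε : |ε| = 1) (hs : ∀ x ∈ Icc a b, |φ'' x| = ε * φ'' x)
    (hl : ∀ x ∈ Icc a b, δ ≤ |φ' x|) :
    ‖∫ x in a..b, Complex.exp (Complex.I * (φ x : ℂ))‖ ≤ 4 / δ := by
  have hu : uIcc a b = Icc a b := uIcc_of_le hab
  have hne : ∀ x ∈ Icc a b, φ' x ≠ 0 := fun x hx h => by
    have := hl x hx
    rw [h, abs_zero] at this
    linarith
  have hcφ' : ContinuousOn φ' (Icc a b) := fun x hx => (h2 x hx).continuousAt.continuousWithinAt
  have hcφ : ContinuousOn φ (Icc a b) := fun x hx => (h1 x hx).continuousAt.continuousWithinAt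
  have hq : ContinuousOn (fun x => -φ'' x / (φ' x) ^ 2) (Icc a b) :=
    hc.neg.div (hcφ'.pow 2) fun x hx => pow_ne_zero 2 (hne x hx)
  have hd : ∀ x ∈ uIcc a b, HasDerivAt (fun x => (φ' x)⁻¹) (-φ'' x / (φ' x) ^ 2) x := by
    intro x hx
    rw [hu] at hx
    exact (h2 x hx).inv (hne x hx)
  have hdI : ∀ x ∈ uIcc a b, HasDerivAt (fun x => -Complex.I * (((φ' x)⁻¹ : ℝ) : ℂ))
      (-Complex.I * ((-φ'' x / (φ' x) ^ 2 : ℝ) : ℂ)) x :=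
    fun x hx => (hd x hx).ofReal_comp.const_mul _
  have hv : ∀ x ∈ uIcc a b, HasDerivAt (fun x => Complex.exp (Complex.I * (φ x : ℂ)))
      (Complex.exp (Complex.I * (φ x : ℂ)) * (Complex.I * (φ' x : ℂ))) x := by
    intro x hx
    rw [hu] at hx
    exact ((h1 x hx).ofReal_comp.const_mul _).cexp
  have hec : ContinuousOn (fun x => Complex.exp (Complex.I * (φ x : ℂ))) (Icc a b) := by fun_prop
  have hint : ∫ x in a..b, Complex.exp (Complex.I * (φ x : ℂ)) =
      ∫ x in a..b, (-Complex.I * (((φ' x)⁻¹ : ℝ) : ℂ)) *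
        (Complex.exp (Complex.I * (φ x : ℂ)) * (Complex.I * (φ' x : ℂ))) := by
    refine intervalIntegral.integral_congr fun x hx => ?_
    rw [hu] at hx
    have h : (φ' x : ℂ) ≠ 0 := by exact_mod_cast hne x hx
    push_cast
    field_simp
    rw [Complex.I_sq]
    ring
  have hi1 : IntervalIntegrable (fun x => -Complex.I * ((-φ'' x / (φ' x) ^ 2 : ℝ) : ℂ))
      volume a b := by
    apply ContinuousOn.intervalIntegrable
    rw [hu]
    exact continuousOn_const.mul (Complex.continuous_ofReal.comp_continuousOn hq)
  have hi2 : IntervalIntegrable (fun x => Complex.exp (Complex.I * (φ x : ℂ)) *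
      (Complex.I * (φ' x : ℂ))) volume a b := by
    apply ContinuousOn.intervalIntegrable
    rw [hu]
    exact hec.mul (continuousOn_const.mul (Complex.continuous_ofReal.comp_continuousOn hcφ'))
  rw [hint, intervalIntegral.integral_mul_deriv_eq_deriv_mul hdI hv hi1 hi2]
  have hexp : ∀ x, ‖Complex.exp (Complex.I * (φ x : ℂ))‖ = 1 := fun x => by
    rw [mul_comm]; exact Complex.norm_exp_ofReal_mul_I _
  have hinv : ∀ x ∈ Icc a b, |(φ' x)⁻¹| ≤ 1 / δ := fun x hx => by
    rw [abs_inv, inv_eq_one_div]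
    exact one_div_le_one_div_of_le hδ (hl x hx)
  have hB : ∀ x ∈ Icc a b, ‖(-Complex.I * (((φ' x)⁻¹ : ℝ) : ℂ)) *
      Complex.exp (Complex.I * (φ x : ℂ))‖ ≤ 1 / δ := fun x hx => by
    rw [norm_mul, hexp, norm_mul, norm_neg, Complex.norm_I, one_mul, mul_one, Complex.norm_real]
    exact hinv x hx
  have hI : ‖∫ x in a..b, (-Complex.I * ((-φ'' x / (φ' x) ^ 2 : ℝ) : ℂ)) *
      Complex.exp (Complex.I * (φ x : ℂ))‖ ≤ 2 / δ := by
    refine (intervalIntegral.norm_integral_le_integral_norm hab).trans ?_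
    have : ∫ x in a..b, ‖(-Complex.I * ((-φ'' x / (φ' x) ^ 2 : ℝ) : ℂ)) *
        Complex.exp (Complex.I * (φ x : ℂ))‖ = ∫ x in a..b, (-ε) * (-φ'' x / (φ' x) ^ 2) := by
      refine intervalIntegral.integral_congr fun x hx => ?_
      rw [hu] at hx
      simp only [norm_mul, hexp, norm_neg, Complex.norm_I, one_mul, mul_one, Complex.norm_real,
        Real.norm_eq_abs, abs_div, abs_neg, hs x hx, abs_pow, sq_abs]
      ring
    rw [this, intervalIntegral.integral_const_mul,
      intervalIntegral.integral_eq_sub_of_hasDerivAt hd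
        (by apply ContinuousOn.intervalIntegrable; rwa [hu])]
    have ha := hinv a (left_mem_Icc.2 hab)
    have hb := hinv b (right_mem_Icc.2 hab)
    calc _ ≤ |(-ε) * ((φ' b)⁻¹ - (φ' a)⁻¹)| := le_abs_self _
      _ = |(φ' b)⁻¹ - (φ' a)⁻¹| := by rw [abs_mul, abs_neg, hε, one_mul]
      _ ≤ |(φ' b)⁻¹| + |(φ' a)⁻¹| := abs_sub _ _
      _ ≤ 1 / δ + 1 / δ := add_le_add hb ha
      _ = 2 / δ := by ring
  calc _ ≤ _ := norm_sub_le _ _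
    _ ≤ (1 / δ + 1 / δ) + 2 / δ := add_le_add ((norm_sub_le _ _).trans
        (add_le_add (hB b (right_mem_Icc.2 hab)) (hB a (left_mem_Icc.2 hab)))) hI
    _ = 4 / δ := by ring

theorem norm_integral_exp_le_length (φ : ℝ → ℝ) {a b : ℝ} (hab : a ≤ b) :
    ‖∫ x in a..b, Complex.exp (Complex.I * (φ x : ℂ))‖ ≤ b - a := by
  have := intervalIntegral.norm_integral_le_of_norm_le_const (a := a) (b := b) (C := 1)
    (f := fun x => Complex.exp (Complex.I * (φ x : ℂ)))
    (fun x _ => by rw [mul_comm]; exact (Complex.norm_exp_ofReal_mul_I _).le)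
  rwa [one_mul, abs_of_nonneg (sub_nonneg.2 hab)] at this

/-- Let `z` minimize `|φ'|`. Whether or not `φ'` vanishes there, `ρ|x - z| ≤ |φ'(x) - φ'(z)| ≤
2|φ'(x)|`. The interval of radius `1/√ρ` around `z` is estimated by its length, and the
first-derivative test applies on both sides of it: `18 = 8 + 2 + 8`. -/
theorem norm_integral_exp_le_of_le_deriv2 {φ φ' φ'' : ℝ → ℝ} {a b ρ ε : ℝ} (hab : a ≤ b)
    (hρ : 0 < ρ) (h1 : ∀ x ∈ Icc a b, HasDerivAt φ (φ' x) x)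
    (h2 : ∀ x ∈ Icc a b, HasDerivAt φ' (φ'' x) x) (hc : ContinuousOn φ'' (Icc a b))
    (hε : |ε| = 1) (hs : ∀ x ∈ Icc a b, |φ'' x| = ε * φ'' x)
    (hl : ∀ x ∈ Icc a b, ρ ≤ |φ'' x|) :
    ‖∫ x in a..b, Complex.exp (Complex.I * (φ x : ℂ))‖ ≤ 18 / √ρ := by
  have hcφ' : ContinuousOn φ' (Icc a b) := fun x hx => (h2 x hx).continuousAt.continuousWithinAt
  have hcφ : ContinuousOn φ (Icc a b) := fun x hx => (h1 x hx).continuousAt.continuousWithinAt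
  have hec : ContinuousOn (fun x => Complex.exp (Complex.I * (φ x : ℂ))) (Icc a b) := by fun_prop
  obtain ⟨z, hz, hmin⟩ := isCompact_Icc.exists_isMinOn (nonempty_Icc.2 hab) hcφ'.abs
  have hmono : ∀ x ∈ Icc a b, ∀ y ∈ Icc a b, x ≤ y → ρ * (y - x) ≤ |φ' y - φ' x| := by
    intro x hx y hy hxy
    have key := (convex_Icc a b).mul_sub_le_image_sub_of_le_deriv (f := fun t => ε * φ' t) (C := ρ)
      (continuousOn_const.mul hcφ')
      (fun t ht => ((h2 t (interior_subset ht)).const_mul ε).differentiableAt.differentiableWithinAt)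
      (fun t ht => by
        rw [((h2 t (interior_subset ht)).const_mul ε).deriv, ← hs t (interior_subset ht)]
        exact hl t (interior_subset ht)) x hx y hy hxy
    calc _ ≤ _ := key
      _ ≤ |ε * φ' y - ε * φ' x| := le_abs_self _
      _ = _ := by rw [← mul_sub, abs_mul, hε, one_mul]
  have hmono' : ∀ x ∈ Icc a b, ρ * |x - z| ≤ |φ' x - φ' z| := by
    intro x hx
    rcases le_total x z with h | h
    · have := hmono x hx z hz h
      rwa [abs_sub_comm, abs_of_nonneg (sub_nonneg.2 h), abs_sub_comm (φ' x)]
    · have := hmono z hz x hx h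
      rwa [abs_of_nonneg (sub_nonneg.2 h)]
  have hlow : ∀ x ∈ Icc a b, ρ * |x - z| / 2 ≤ |φ' x| := by
    intro x hx
    have h3 := hmono' x hx
    have h4 : |φ' z| ≤ |φ' x| := hmin hx
    have h5 := abs_sub (φ' x) (φ' z)
    linarith
  set σ := √ρ with hσ
  have hσ0 : 0 < σ := Real.sqrt_pos.2 hρ
  have hσ2 : σ * σ = ρ := Real.mul_self_sqrt hρ.le
  set p := max a (z - 1 / σ) with hp
  set q := min b (z + 1 / σ) with hq
  have hη : 0 < 1 / σ := by positivity
  have hap : a ≤ p := le_max_left _ _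
  have hqb : q ≤ b := min_le_left _ _
  have hpz : p ≤ z := max_le hz.1 (by linarith)
  have hzq : z ≤ q := le_min hz.2 (by linarith)
  have hout : ∀ c d, a ≤ c → c ≤ d → d ≤ b → (c < d → ∀ x ∈ Icc c d, 1 / σ ≤ |x - z|) →
      ‖∫ x in c..d, Complex.exp (Complex.I * (φ x : ℂ))‖ ≤ 8 / σ := by
    intro c d hac hcd hdb hx
    rcases hcd.eq_or_lt with rfl | hlt
    · simp only [intervalIntegral.integral_same, norm_zero]; positivity
    have hsub : Icc c d ⊆ Icc a b := Icc_subset_Icc hac hdb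
    have := norm_integral_exp_le_of_le_deriv (φ := φ) (φ' := φ') (φ'' := φ'') (δ := σ / 2) hcd
      (by positivity) (fun x hx => h1 x (hsub hx)) (fun x hx => h2 x (hsub hx)) (hc.mono hsub) hε
      (fun x hx => hs x (hsub hx)) (fun x hx' => by
        refine le_trans ?_ (hlow x (hsub hx'))
        have h6 := mul_le_mul_of_nonneg_left (hx hlt x hx') hρ.le
        rw [← hσ2] at h6 ⊢
        have : σ * σ * (1 / σ) = σ := by field_simp
        linarith)
    refine this.trans (le_of_eq ?_)
    field_simp
    norm_num
  have hA := hout a p le_rfl hap (hpz.trans hz.2) (fun hlt x hx => by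
    have : p = z - 1 / σ := by
      rcases max_cases a (z - 1 / σ) with h | h
      · rw [hp, h.1] at hlt; exact absurd hlt (lt_irrefl _)
      · exact h.1
    rw [abs_sub_comm]
    exact le_trans (by have := hx.2; linarith) (le_abs_self _))
  have hC := hout q b (hz.1.trans hzq) hqb le_rfl (fun hlt x hx => by
    have : q = z + 1 / σ := by
      rcases min_cases b (z + 1 / σ) with h | h
      · rw [hq, h.1] at hlt; exact absurd hlt (lt_irrefl _)
      · exact h.1
    exact le_trans (by have := hx.1; linarith) (le_abs_self _))
  have hM := norm_integral_exp_le_length φ (hpz.trans hzq)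
  have hpl : z - 1 / σ ≤ p := le_max_right _ _
  have hql : q ≤ z + 1 / σ := min_le_right _ _
  have hint : ∀ c d, c ∈ Icc a b → d ∈ Icc a b → IntervalIntegrable
      (fun x => Complex.exp (Complex.I * (φ x : ℂ))) volume c d := fun c d hc' hd' =>
    (hec.mono (uIcc_subset_Icc hc' hd')).intervalIntegrable
  have ha' : a ∈ Icc a b := left_mem_Icc.2 hab
  have hb' : b ∈ Icc a b := right_mem_Icc.2 hab
  have hp' : p ∈ Icc a b := ⟨hap, hpz.trans hz.2⟩
  have hq' : q ∈ Icc a b := ⟨hz.1.trans hzq, hqb⟩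
  rw [← intervalIntegral.integral_add_adjacent_intervals (hint a p ha' hp') (hint p b hp' hb'),
    ← intervalIntegral.integral_add_adjacent_intervals (hint p q hp' hq') (hint q b hq' hb')]
  calc _ ≤ _ := (norm_add_le _ _).trans (add_le_add_right (norm_add_le _ _) _)
    _ ≤ 8 / σ + ((q - p) + 8 / σ) := add_le_add hA (add_le_add hM hC)
    _ ≤ 8 / σ + (2 * (1 / σ) + 8 / σ) := by linarith
    _ = 18 / σ := by ring

/-! ### The oscillatory kernel -/

/-- The derivative formula for `t ^ κ` holds at every real `t` when `κ ≥ 1`, with the total real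
power, so negative times need no separate treatment and no integrality of `κ`. -/
theorem abs_rpow_sub_rpow_le {κ : ℝ} (hκ : 1 ≤ κ) {t t' : ℝ} (ht : |t| ≤ 1) (ht' : |t'| ≤ 1) :
    |t ^ κ - t' ^ κ| ≤ κ * |t - t'| := by
  refine Convex.norm_image_sub_le_of_norm_hasDerivWithin_le (𝕜 := ℝ) (s := Icc (-1 : ℝ) 1)
    (f := fun t : ℝ => t ^ κ) (fun x _ => (Real.hasDerivAt_rpow_const (Or.inr hκ)).hasDerivWithinAt)
    (fun x hx => ?_) (convex_Icc _ _) (abs_le.1 ht') (abs_le.1 ht)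
  rw [norm_mul, Real.norm_eq_abs, Real.norm_eq_abs, abs_of_nonneg (by linarith : 0 ≤ κ)]
  refine mul_le_of_le_one_right (by linarith) ((Real.abs_rpow_le_abs_rpow _ _).trans ?_)
  exact Real.rpow_le_one (abs_nonneg _) (abs_le.2 hx) (by linarith)

/-- Applied with `r = x - y`, `τ = t(x) - t(y)` and `u` the difference of the curve points. The
squared form lets both regimes of `|τ|` against `|r|` be stated with one right-hand side. -/
theorem sq_norm_oscillatory_le {m L lam a c r τ u : ℝ} (hm : m ∈ Ioo (0 : ℝ) 1) (hL : 0 ≤ L)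
    (hlam : 1 ≤ lam) (ha : lam ≤ a) (hac : a ≤ c) (hc : c ≤ 2 * lam) (hr : r ≠ 0)
    (hu : |u - r| ≤ L * |τ|) :
    ‖∫ x in a..c, Complex.exp (Complex.I * ((u * x + τ * x ^ m : ℝ) : ℂ))‖ ^ 2 ≤
      (8 + 324 * (2 * (L + 1)) * 2 ^ (2 - m) / (m * (1 - m))) * (lam ^ (2 - m) / |r|) := by
  obtain ⟨hm0, hm1⟩ := hm
  have hr0 : 0 < |r| := abs_pos.2 hr
  have hlam0 : 0 < lam := by linarith
  have hmm : 0 < m * (1 - m) := mul_pos hm0 (by linarith)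
  have hx1 : ∀ x ∈ Icc a c, 1 ≤ x := fun x hx => hlam.trans (ha.trans hx.1)
  have h1 : ∀ x ∈ Icc a c, HasDerivAt (fun x : ℝ => u * x + τ * x ^ m)
      (u + τ * (m * x ^ (m - 1))) x := fun x hx => by
    have hx0 : x ≠ 0 := by have := hx1 x hx; positivity
    have := ((hasDerivAt_id x).const_mul u).add
      ((Real.hasDerivAt_rpow_const (p := m) (Or.inl hx0)).const_mul τ)
    rw [mul_one] at this
    exact this
  have h2 : ∀ x ∈ Icc a c, HasDerivAt (fun x : ℝ => u + τ * (m * x ^ (m - 1)))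
      (τ * (m * ((m - 1) * x ^ (m - 2)))) x := fun x hx => by
    have hx0 : x ≠ 0 := by have := hx1 x hx; positivity
    have := (((Real.hasDerivAt_rpow_const (p := m - 1) (Or.inl hx0)).const_mul m).const_mul
      τ).const_add u
    rwa [show m - 1 - 1 = m - 2 by ring] at this
  have hcont : ContinuousOn (fun x : ℝ => τ * (m * ((m - 1) * x ^ (m - 2)))) (Icc a c) := by
    refine continuousOn_const.mul (continuousOn_const.mul (continuousOn_const.mul ?_))
    exact ContinuousOn.rpow_const continuousOn_id fun x hx =>
      Or.inl (by have := hx1 x hx; show x ≠ 0; positivity)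
  have habs : ∀ x ∈ Icc a c, |τ * (m * ((m - 1) * x ^ (m - 2)))| =
      |τ| * (m * (1 - m)) * x ^ (m - 2) := fun x hx => by
    have hx0 : 0 ≤ x ^ (m - 2) := Real.rpow_nonneg (by linarith [hx1 x hx]) _
    rw [abs_mul, abs_mul, abs_mul, abs_of_pos hm0, abs_of_nonneg hx0,
      abs_of_neg (by linarith : m - 1 < 0)]
    ring
  obtain ⟨ε, hε, hετ⟩ : ∃ ε : ℝ, |ε| = 1 ∧ |τ| = - ε * τ := by
    rcases le_total 0 τ with h | h
    · exact ⟨-1, by simp, by rw [abs_of_nonneg h]; ring⟩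
    · exact ⟨1, by simp, by rw [abs_of_nonpos h]; ring⟩
  have hs : ∀ x ∈ Icc a c, |τ * (m * ((m - 1) * x ^ (m - 2)))| =
      ε * (τ * (m * ((m - 1) * x ^ (m - 2)))) := fun x hx => by
    rw [habs x hx, hετ]; ring
  set X := ‖∫ x in a..c, Complex.exp (Complex.I * ((u * x + τ * x ^ m : ℝ) : ℂ))‖ with hX
  have hX0 : 0 ≤ X := norm_nonneg _
  have hXl : X ≤ lam :=
    (norm_integral_exp_le_length (fun x : ℝ => u * x + τ * x ^ m) hac).trans (by linarith)
  have hp1 : lam ≤ lam ^ (2 - m) := by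
    simpa using Real.rpow_le_rpow_of_exponent_le hlam (by linarith : (1 : ℝ) ≤ 2 - m)
  have hpos : 0 ≤ lam ^ (2 - m) / |r| := by positivity
  have hL1 : 0 < L + 1 := by linarith
  rw [add_mul]
  -- For small `|τ|` the derivative of the phase is at least `|r|/2`, and one of the two factors of
  -- `X ^ 2` is bounded by the length of the interval. For large `|τ|` the second derivative test is
  -- used with `|τ| > |r| / (2(L+1))`.
  rcases le_or_gt (2 * (L + 1) * |τ|) |r| with hA | hB
  · have hlow : ∀ x ∈ Icc a c, |r| / 2 ≤ |u + τ * (m * x ^ (m - 1))| := fun x hx => by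
      have hx0 : 0 ≤ x ^ (m - 1) := Real.rpow_nonneg (by linarith [hx1 x hx]) _
      have hx2 : x ^ (m - 1) ≤ 1 := Real.rpow_le_one_of_one_le_of_nonpos (hx1 x hx) (by linarith)
      have h3 : |τ * (m * x ^ (m - 1))| ≤ |τ| := by
        rw [abs_mul, abs_of_nonneg (mul_nonneg hm0.le hx0)]
        exact mul_le_of_le_one_right (abs_nonneg _) (by nlinarith)
      have h4 : |r| ≤ |u + τ * (m * x ^ (m - 1))| + |u - r| + |τ * (m * x ^ (m - 1))| := by
        calc |r| = |(u + τ * (m * x ^ (m - 1))) - (u - r) - τ * (m * x ^ (m - 1))| := by ring_nf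
          _ ≤ _ := (abs_sub _ _).trans (add_le_add_left (abs_sub _ _) _)
      nlinarith [abs_nonneg τ]
    have h5 : X ≤ 4 / (|r| / 2) := norm_integral_exp_le_of_le_deriv hac (by positivity) h1 h2 hcont
      hε hs hlow
    have h6 : X ^ 2 ≤ 8 * (lam ^ (2 - m) / |r|) := by
      calc X ^ 2 = X * X := sq X
        _ ≤ 4 / (|r| / 2) * lam ^ (2 - m) := mul_le_mul h5 (hXl.trans hp1) hX0 (by positivity)
        _ = _ := by field_simp; ring
    have : 0 ≤ 324 * (2 * (L + 1)) * 2 ^ (2 - m) / (m * (1 - m)) * (lam ^ (2 - m) / |r|) := by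
      positivity
    linarith
  · have hτ : 0 < |τ| := by
      by_contra h
      have : |τ| = 0 := le_antisymm (not_lt.1 h) (abs_nonneg _)
      rw [this, mul_zero] at hB
      linarith
    set ρ := |τ| * (m * (1 - m)) * (2 * lam) ^ (m - 2) with hρ
    have hρ0 : 0 < ρ := by positivity
    have h5 : X ≤ 18 / √ρ := norm_integral_exp_le_of_le_deriv2 hac hρ0 h1 h2 hcont hε hs
      (fun x hx => by
        rw [habs x hx, hρ]
        refine mul_le_mul_of_nonneg_left ?_ (by positivity)
        exact Real.rpow_le_rpow_of_nonpos (by linarith [hx1 x hx]) (hx.2.trans hc) (by linarith))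
    have h6 : X ^ 2 ≤ 324 / ρ := by
      calc X ^ 2 ≤ (18 / √ρ) ^ 2 := by gcongr
        _ = _ := by rw [div_pow, Real.sq_sqrt hρ0.le]; norm_num
    have h7 : 324 / ρ ≤ 324 * (2 * (L + 1)) * 2 ^ (2 - m) / (m * (1 - m)) *
        (lam ^ (2 - m) / |r|) := by
      have e1 : (2 * lam) ^ (m - 2) = (2 ^ (2 - m) * lam ^ (2 - m))⁻¹ := by
        rw [← Real.mul_rpow (by norm_num) hlam0.le, ← Real.rpow_neg (by positivity)]
        ring_nf
      rw [hρ, e1, div_le_iff₀ (by positivity)]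
      have : 324 * (2 * (L + 1)) * 2 ^ (2 - m) / (m * (1 - m)) * (lam ^ (2 - m) / |r|) *
          (|τ| * (m * (1 - m)) * (2 ^ (2 - m) * lam ^ (2 - m))⁻¹) =
          324 * (2 * (L + 1) * |τ| / |r|) := by
        have : (1 - m) ≠ 0 := by linarith
        field_simp
      rw [this]
      have : 1 ≤ 2 * (L + 1) * |τ| / |r| := by rw [le_div_iff₀ hr0]; linarith
      linarith
    have : 0 ≤ 8 * (lam ^ (2 - m) / |r|) := by positivity
    linarith

/-- Geometric mean of the previous bound and the trivial bound by `lam`. A smaller `b` weakens the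
singularity in `r`, so that rougher measures have finite potential, and costs powers of `lam`. -/
theorem exists_norm_oscillatory_le {m L b : ℝ} (hm : m ∈ Ioo (0 : ℝ) 1) (hL : 0 ≤ L)
    (hb0 : 0 ≤ b) (hb : b ≤ 1 / 2) :
    ∃ C : ℝ, 0 < C ∧ ∀ lam a c r τ u : ℝ, 1 ≤ lam → lam ≤ a → a ≤ c → c ≤ 2 * lam → r ≠ 0 →
      |u - r| ≤ L * |τ| →
      ‖∫ x in a..c, Complex.exp (Complex.I * ((u * x + τ * x ^ m : ℝ) : ℂ))‖ ≤
        C * (lam ^ (1 - m * b) * |r| ^ (-b)) := by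
  have hmm : 0 < m * (1 - m) := mul_pos hm.1 (by linarith [hm.2])
  set D := 8 + 324 * (2 * (L + 1)) * 2 ^ (2 - m) / (m * (1 - m)) with hD
  have hD0 : 0 < D := by positivity
  refine ⟨D ^ b, by positivity, fun lam a c r τ u hlam ha hac hc hr hu => ?_⟩
  have key := sq_norm_oscillatory_le hm hL hlam ha hac hc hr hu
  rw [← hD] at key
  have hXl := (norm_integral_exp_le_length (fun x : ℝ => u * x + τ * x ^ m) hac)
  set X := ‖∫ x in a..c, Complex.exp (Complex.I * ((u * x + τ * x ^ m : ℝ) : ℂ))‖ with hX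
  have hX0 : 0 ≤ X := norm_nonneg _
  have hlam0 : 0 < lam := by linarith
  have hr0 : 0 < |r| := abs_pos.2 hr
  calc X = X ^ (1 - 2 * b) * (X ^ 2) ^ b := by
        rw [← Real.rpow_natCast, ← Real.rpow_mul hX0]
        push_cast
        rcases hX0.eq_or_lt with h | h
        · rcases hb.eq_or_lt with h' | h'
          · rw [h']; norm_num
          · rw [← h, Real.zero_rpow (by linarith), zero_mul]
        · rw [← Real.rpow_add h]; ring_nf; simp
    _ ≤ lam ^ (1 - 2 * b) * (D * (lam ^ (2 - m) / |r|)) ^ b := by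
        gcongr
        · linarith
        · linarith
    _ = D ^ b * (lam ^ (1 - m * b) * |r| ^ (-b)) := by
        rw [Real.mul_rpow hD0.le (by positivity), Real.div_rpow (by positivity) hr0.le,
          ← Real.rpow_mul hlam0.le, Real.rpow_neg hr0.le]
        have : lam ^ (1 - m * b) = lam ^ (1 - 2 * b) * lam ^ ((2 - m) * b) := by
          rw [← Real.rpow_add hlam0]; ring_nf
        rw [this]
        ring

/-! ### Frequency annuli -/

/-- The set of frequencies `ξ` with `a < |ξ| ≤ c`. -/
def annulus (a c : ℝ) : Set ℝ := {ξ | a < |ξ| ∧ |ξ| ≤ c}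

theorem measurableSet_annulus (a c : ℝ) : MeasurableSet (annulus a c) :=
  (measurableSet_lt measurable_const measurable_norm).inter
    (measurableSet_le measurable_norm measurable_const)

theorem annulus_subset_Icc (a c : ℝ) : annulus a c ⊆ Icc (-c) c := fun _ h => abs_le.1 h.2

theorem volume_annulus_lt_top (a c : ℝ) : volume (annulus a c) < ∞ :=
  (measure_mono (annulus_subset_Icc a c)).trans_lt measure_Icc_lt_top

theorem annulus_eq_union {a c : ℝ} (ha : 0 ≤ a) : annulus a c = Ioc a c ∪ Ico (-c) (-a) := by
  ext ξ
  simp only [annulus, mem_ofPred_eq, mem_union, mem_Ioc, mem_Ico]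
  rcases le_total 0 ξ with h | h
  · rw [abs_of_nonneg h]
    refine ⟨Or.inl, fun h' => h'.elim id fun h' => ?_⟩
    exfalso; linarith [h'.2]
  · rw [abs_of_nonpos h]
    refine ⟨fun h' => Or.inr ⟨by linarith, by linarith⟩, fun h' => h'.elim (fun h' => ?_) fun h' => ?_⟩
    · exfalso; linarith [h'.1]
    · exact ⟨by linarith [h'.2], by linarith [h'.1]⟩

theorem continuous_phase {m : ℝ} (hm : 0 < m) (u τ : ℝ) :
    Continuous fun ξ : ℝ => Complex.exp (Complex.I * ((u * ξ + τ * |ξ| ^ m : ℝ) : ℂ)) := by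
  have : Continuous fun ξ : ℝ => |ξ| ^ m := continuous_abs.rpow_const fun _ => Or.inr hm.le
  fun_prop

theorem norm_exp_I_mul_ofReal' (x : ℝ) : ‖Complex.exp (Complex.I * (x : ℂ))‖ = 1 := by
  rw [mul_comm]; exact Complex.norm_exp_ofReal_mul_I _

theorem exists_norm_annulus_integral_le {m L b : ℝ} (hm : m ∈ Ioo (0 : ℝ) 1) (hL : 0 ≤ L)
    (hb0 : 0 ≤ b) (hb : b ≤ 1 / 2) :
    ∃ C : ℝ, 0 < C ∧ ∀ lam c r τ u : ℝ, 1 ≤ lam → c ≤ 2 * lam → r ≠ 0 → |u - r| ≤ L * |τ| →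
      ‖∫ x in annulus lam c, Complex.exp (Complex.I * ((u * x + τ * |x| ^ m : ℝ) : ℂ))‖ ≤
        C * (lam ^ (1 - m * b) * |r| ^ (-b)) := by
  obtain ⟨C, hC, h⟩ := exists_norm_oscillatory_le hm hL hb0 hb
  refine ⟨C + C, by positivity, fun lam c r τ u hlam hc hr hu => ?_⟩
  rcases le_or_gt c lam with hcl | hcl
  · have : annulus lam c = ∅ := by
      ext ξ
      simp only [annulus, mem_ofPred_eq, mem_empty_iff_false, iff_false]
      rintro ⟨h1, h2⟩
      linarith
    rw [this, Measure.restrict_empty, integral_zero_measure, norm_zero]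
    positivity
  have hdisj : Disjoint (Ioc lam c) (Ico (-c) (-lam)) := by
    rw [Set.disjoint_left]
    intro x hx hx'
    linarith [hx.1, hx'.2]
  have hcont := continuous_phase hm.1 u τ
  have hI : ∀ s : Set ℝ, s ⊆ Icc (-c) c → IntegrableOn
      (fun ξ : ℝ => Complex.exp (Complex.I * ((u * ξ + τ * |ξ| ^ m : ℝ) : ℂ))) s :=
    fun s hs => (hcont.continuousOn.integrableOn_compact isCompact_Icc).mono_set hs
  rw [annulus_eq_union (by linarith), setIntegral_union hdisj measurableSet_Ico
    (hI _ fun x hx => ⟨by linarith [hx.1], hx.2⟩) (hI _ fun x hx => ⟨hx.1, by linarith [hx.2]⟩),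
    add_mul]
  refine (norm_add_le _ _).trans (add_le_add ?_ ?_)
  · rw [← intervalIntegral.integral_of_le hcl.le]
    refine le_trans (le_of_eq ?_) (h lam lam c r τ u hlam le_rfl hcl.le hc hr hu)
    congr 1
    refine intervalIntegral.integral_congr fun x hx => ?_
    rw [uIcc_of_le hcl.le] at hx
    simp only [abs_of_nonneg (by linarith [hx.1] : 0 ≤ x)]
  -- Reflecting `ξ` changes the signs of `u` and `r` together, which preserves `|u - r|`.
  · rw [integral_Ico_eq_integral_Ioc, ← intervalIntegral.integral_of_le (by linarith),
      ← intervalIntegral.integral_comp_neg]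
    have := h lam lam c (-r) τ (-u) hlam le_rfl hcl.le hc (neg_ne_zero.2 hr)
      (by rwa [neg_sub_neg, abs_sub_comm])
    rw [abs_neg] at this
    refine le_trans (le_of_eq ?_) this
    congr 1
    refine intervalIntegral.integral_congr fun x hx => ?_
    rw [uIcc_of_le hcl.le] at hx
    simp only [abs_neg, abs_of_nonneg (by linarith [hx.1] : 0 ≤ x), mul_neg, neg_mul]

/-! ### The `TT*` argument -/

theorem lintegral_enorm_sq_eq {α : Type*} [MeasurableSpace α] {ν : Measure α} {F : α → ℂ}
    (hF : Integrable (fun x => F x * starRingEnd ℂ (F x)) ν) :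
    ∫⁻ x, ‖F x‖ₑ ^ 2 ∂ν = ‖∫ x, F x * starRingEnd ℂ (F x) ∂ν‖ₑ := by
  have e : ∀ x, F x * starRingEnd ℂ (F x) = ((‖F x‖ ^ 2 : ℝ) : ℂ) := fun x => by
    rw [Complex.mul_conj, Complex.normSq_eq_norm_sq]
  have hF' : Integrable (fun x => ‖F x‖ ^ 2) ν := by
    have := hF.norm
    simp only [norm_mul, RCLike.norm_conj] at this
    simpa only [sq] using this
  simp_rw [e]
  rw [integral_complex_ofReal, enorm_eq_nnnorm, Complex.nnnorm_real, ← enorm_eq_nnnorm,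
    Real.enorm_of_nonneg (integral_nonneg fun x => by positivity),
    ofReal_integral_eq_lintegral_ofReal hF' (ae_of_all _ fun x => by positivity)]
  refine lintegral_congr fun x => ?_
  rw [ENNReal.ofReal_pow (norm_nonneg _), ofReal_norm]

/-- With `F = Th` and `H` the conjugate of `T*F`, duality and Cauchy–Schwarz give `‖F‖² ≤ ‖h‖ ‖H‖`.
Expanding `‖H‖²` produces the kernel of `TT*`, to which Schur's test applies, so `‖H‖² ≤ 2B ‖F‖²`. A
factor `‖F‖²` is then cancelled. -/
theorem lintegral_sq_le_of_kernel {α β : Type*} [MeasurableSpace α] [MeasurableSpace β]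
    {ν : Measure α} [IsFiniteMeasure ν] {σ : Measure β} [IsFiniteMeasure σ]
    {E : α → β → ℂ} (hE : Measurable (Function.uncurry E)) (hE1 : ∀ x ξ, ‖E x ξ‖ ≤ 1)
    {h : β → ℂ} (hm : Measurable h) (hh : Integrable h σ)
    {k : α → α → ℝ≥0∞} (hk : Measurable (Function.uncurry k)) (hsymm : ∀ x y, k x y = k y x)
    (hK : ∀ x y, ‖∫ ξ, E x ξ * starRingEnd ℂ (E y ξ) ∂σ‖ₑ ≤ k x y)
    {B : ℝ≥0∞} (hB : ∀ x, ∫⁻ y, k x y ∂ν ≤ B) :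
    ∫⁻ x, ‖∫ ξ, E x ξ * h ξ ∂σ‖ₑ ^ 2 ∂ν ≤ 2 * B * ∫⁻ ξ, ‖h ξ‖ₑ ^ 2 ∂σ := by
  set F : α → ℂ := fun x => ∫ ξ, E x ξ * h ξ ∂σ with hFdef
  have hconj : Measurable (starRingEnd ℂ : ℂ → ℂ) := Complex.continuous_conj.measurable
  have hFm : Measurable F := by
    have : StronglyMeasurable (Function.uncurry fun x ξ => E x ξ * h ξ) :=
      (hE.mul (hm.comp measurable_snd)).stronglyMeasurable
    exact this.integral_prod_right.measurable
  obtain ⟨R, hR⟩ : ∃ R, ∀ x, ‖F x‖ ≤ R := by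
    refine ⟨∫ ξ, ‖h ξ‖ ∂σ, fun x => (norm_integral_le_integral_norm _).trans ?_⟩
    refine integral_mono_of_nonneg (ae_of_all _ fun _ => norm_nonneg _) hh.norm
      (ae_of_all _ fun ξ => ?_)
    simp only [norm_mul]
    exact mul_le_of_le_one_left (norm_nonneg _) (hE1 x ξ)
  set H : β → ℂ := fun ξ => ∫ x, starRingEnd ℂ (F x) * E x ξ ∂ν with hHdef
  have hHm : Measurable H := by
    have : StronglyMeasurable (Function.uncurry fun ξ x => starRingEnd ℂ (F x) * E x ξ) :=
      ((hconj.comp (hFm.comp measurable_snd)).mul (hE.comp measurable_swap)).stronglyMeasurable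
    exact this.integral_prod_right.measurable
  have hFE : ∀ x ξ, ‖starRingEnd ℂ (F x) * E x ξ‖ ≤ R := fun x ξ => by
    rw [norm_mul, RCLike.norm_conj]
    exact (mul_le_of_le_one_right (norm_nonneg _) (hE1 x ξ)).trans (hR x)
  have hHb : ∀ ξ, ‖H ξ‖ ≤ R * ν.real univ := fun ξ =>
    norm_integral_le_of_norm_le_const (ae_of_all _ fun x => hFE x ξ)
  have hFF : Integrable (fun x => F x * starRingEnd ℂ (F x)) ν := by
    refine Integrable.of_bound (hFm.mul (hconj.comp hFm)).aestronglyMeasurable (R * R)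
      (ae_of_all _ fun x => ?_)
    rw [norm_mul, RCLike.norm_conj]
    exact mul_le_mul (hR x) (hR x) (norm_nonneg _) ((norm_nonneg _).trans (hR x))
  have hHH : Integrable (fun ξ => H ξ * starRingEnd ℂ (H ξ)) σ := by
    refine Integrable.of_bound (hHm.mul (hconj.comp hHm)).aestronglyMeasurable
      (R * ν.real univ * (R * ν.real univ)) (ae_of_all _ fun x => ?_)
    rw [norm_mul, RCLike.norm_conj]
    exact mul_le_mul (hHb x) (hHb x) (norm_nonneg _) ((norm_nonneg _).trans (hHb x))
  set A := ∫⁻ x, ‖F x‖ₑ ^ 2 ∂ν with hA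
  -- Needed for the final cancellation; it holds because `F` is bounded and `ν` is finite.
  have hAfin : A ≠ ∞ := by rw [hA, lintegral_enorm_sq_eq hFF]; exact enorm_ne_top
  have step1 : ∫ x, F x * starRingEnd ℂ (F x) ∂ν = ∫ ξ, h ξ * H ξ ∂σ := by
    have e1 : ∀ x, F x * starRingEnd ℂ (F x) =
        ∫ ξ, h ξ * (starRingEnd ℂ (F x) * E x ξ) ∂σ := fun x => by
      rw [mul_comm, hFdef, ← integral_const_mul]
      exact integral_congr_ae (ae_of_all _ fun ξ => by simp only; ring)
    simp_rw [e1]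
    rw [integral_integral_swap]
    · exact integral_congr_ae (ae_of_all _ fun ξ => by simp only [hHdef, integral_const_mul])
    · refine Integrable.mono' ((hh.norm.const_mul R).comp_snd ν) ?_ (ae_of_all _ fun z => ?_)
      · exact ((hm.comp measurable_snd).mul ((hconj.comp (hFm.comp measurable_fst)).mul
          hE)).aestronglyMeasurable
      · simp only [Function.uncurry]
        rw [norm_mul, mul_comm]
        exact mul_le_mul_of_nonneg_right (hFE _ _) (norm_nonneg _)
  have step2 : A ≤ (∫⁻ ξ, ‖h ξ‖ₑ ^ 2 ∂σ) ^ (1 / 2 : ℝ) * (∫⁻ ξ, ‖H ξ‖ₑ ^ 2 ∂σ) ^ (1 / 2 : ℝ) := by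
    rw [hA, lintegral_enorm_sq_eq hFF, step1]
    refine (enorm_integral_le_lintegral_enorm _).trans ?_
    have := ENNReal.lintegral_mul_le_Lp_mul_Lq σ (p := 2) (q := 2) (by constructor <;> norm_num)
      hm.enorm.aemeasurable hHm.enorm.aemeasurable
    simpa only [Pi.mul_apply, ← enorm_mul, ENNReal.rpow_two] using this
  have step3 : ∫⁻ ξ, ‖H ξ‖ₑ ^ 2 ∂σ ≤ 2 * B * A := by
    have e2 : ∀ ξ, H ξ * starRingEnd ℂ (H ξ) = ∫ z : α × α, (starRingEnd ℂ (F z.1) * F z.2) *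
        (E z.1 ξ * starRingEnd ℂ (E z.2 ξ)) ∂(ν.prod ν) := fun ξ => by
      rw [hHdef]
      simp only
      rw [← integral_conj, ← integral_prod_mul]
      refine integral_congr_ae (ae_of_all _ fun z => ?_)
      simp only [map_mul, Complex.conj_conj]
      ring
    rw [lintegral_enorm_sq_eq hHH]
    simp_rw [e2]
    rw [integral_integral_swap]
    · refine (enorm_integral_le_lintegral_enorm _).trans ?_
      have hkm : Measurable fun z : α × α => k z.1 z.2 := hk
      calc ∫⁻ z : α × α, ‖∫ ξ, (starRingEnd ℂ (F z.1) * F z.2) *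
              (E z.1 ξ * starRingEnd ℂ (E z.2 ξ)) ∂σ‖ₑ ∂(ν.prod ν)
          ≤ ∫⁻ z : α × α, (‖F z.1‖ₑ ^ 2 * k z.1 z.2 + ‖F z.2‖ₑ ^ 2 * k z.2 z.1) ∂(ν.prod ν) := by
            refine lintegral_mono fun z => ?_
            rw [integral_const_mul, enorm_mul, enorm_mul, RCLike.enorm_conj, ← hsymm z.1 z.2,
              ← add_mul]
            refine mul_le_mul' ?_ (hK _ _)
            -- The product is at most the larger square; this crude bound is the source of the
            -- factor 2.
            rcases le_total ‖F z.1‖ₑ ‖F z.2‖ₑ with h | h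
            · exact (mul_le_mul_left h _).trans (by rw [← sq]; exact le_add_self)
            · exact (mul_le_mul_right h _).trans (by rw [← sq]; exact le_self_add)
        _ = (∫⁻ z : α × α, ‖F z.1‖ₑ ^ 2 * k z.1 z.2 ∂(ν.prod ν)) +
            ∫⁻ z : α × α, ‖F z.2‖ₑ ^ 2 * k z.2 z.1 ∂(ν.prod ν) :=
            lintegral_add_left (((hFm.comp measurable_fst).enorm.pow_const 2).mul hkm) _
        _ = (∫⁻ z : α × α, ‖F z.1‖ₑ ^ 2 * k z.1 z.2 ∂(ν.prod ν)) +
            ∫⁻ z : α × α, ‖F z.1‖ₑ ^ 2 * k z.1 z.2 ∂(ν.prod ν) := by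
            congr 1
            exact lintegral_prod_swap (μ := ν) (ν := ν)
              (fun z : α × α => ‖F z.1‖ₑ ^ 2 * k z.1 z.2)
        _ = 2 * ∫⁻ x, ∫⁻ y, ‖F x‖ₑ ^ 2 * k x y ∂ν ∂ν := by
            rw [← two_mul, lintegral_prod (fun z : α × α => ‖F z.1‖ₑ ^ 2 * k z.1 z.2)
              (((hFm.comp measurable_fst).enorm.pow_const 2).mul hkm).aemeasurable]
        _ ≤ 2 * ∫⁻ x, ‖F x‖ₑ ^ 2 * B ∂ν := by
            gcongr with x
            rw [lintegral_const_mul _ hk.of_uncurry_left]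
            gcongr
            exact hB x
        _ = 2 * B * A := by rw [lintegral_mul_const _ (hFm.enorm.pow_const 2)]; ring
    · refine Integrable.of_bound (C := R * R) ?_ (ae_of_all _ fun z => ?_)
      · have m1 : Measurable fun z : β × (α × α) => F z.2.1 :=
          hFm.comp (measurable_fst.comp measurable_snd)
        have m2 : Measurable fun z : β × (α × α) => F z.2.2 :=
          hFm.comp (measurable_snd.comp measurable_snd)
        have m3 : Measurable fun z : β × (α × α) => E z.2.1 z.1 :=
          hE.comp ((measurable_fst.comp measurable_snd).prodMk measurable_fst)
        have m4 : Measurable fun z : β × (α × α) => E z.2.2 z.1 :=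
          hE.comp ((measurable_snd.comp measurable_snd).prodMk measurable_fst)
        exact (((hconj.comp m1).mul m2).mul (m3.mul (hconj.comp m4))).aestronglyMeasurable
      · simp only [Function.uncurry]
        have : (starRingEnd ℂ (F z.2.1) * F z.2.2) * (E z.2.1 z.1 * starRingEnd ℂ (E z.2.2 z.1)) =
          (starRingEnd ℂ (F z.2.1) * E z.2.1 z.1) *
            starRingEnd ℂ (starRingEnd ℂ (F z.2.2) * E z.2.2 z.1) := by
          simp only [map_mul, Complex.conj_conj]; ring
        rw [this, norm_mul, RCLike.norm_conj]
        exact mul_le_mul (hFE _ _) (hFE _ _) (norm_nonneg _) ((norm_nonneg _).trans (hR z.2.1))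
  rcases eq_or_ne A 0 with h0 | h0
  · rw [h0]; exact zero_le
  have h4 : A * A ≤ (2 * B * ∫⁻ ξ, ‖h ξ‖ₑ ^ 2 ∂σ) * A := by
    calc A * A ≤ _ := mul_le_mul' step2 step2
      _ = (∫⁻ ξ, ‖h ξ‖ₑ ^ 2 ∂σ) * ∫⁻ ξ, ‖H ξ‖ₑ ^ 2 ∂σ := by
        rw [mul_mul_mul_comm, ← ENNReal.rpow_add_of_nonneg _ _ (by norm_num) (by norm_num),
          ← ENNReal.rpow_add_of_nonneg _ _ (by norm_num) (by norm_num)]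
        norm_num
      _ ≤ (∫⁻ ξ, ‖h ξ‖ₑ ^ 2 ∂σ) * (2 * B * A) := by gcongr
      _ = _ := by ring
  exact (ENNReal.mul_le_mul_iff_left h0 hAfin).1 h4

/-! ### Dyadic intervals and a discrete Frostman lemma -/

/-- The half-open dyadic interval `[i 2^{-k}, (i+1) 2^{-k})`. -/
def cell (k : ℕ) (i : ℤ) : Set ℝ := {x | ⌊2 ^ k * x⌋ = i}

theorem mem_cell {k : ℕ} {i : ℤ} {x : ℝ} : x ∈ cell k i ↔ ⌊2 ^ k * x⌋ = i := Iff.rfl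

theorem cell_eq_Ico (k : ℕ) (i : ℤ) : cell k i = Ico ((i : ℝ) / 2 ^ k) ((i + 1) / 2 ^ k) := by
  ext x
  have h : (0 : ℝ) < 2 ^ k := by positivity
  rw [mem_cell, Int.floor_eq_iff, mem_Ico, div_le_iff₀ h, lt_div_iff₀ h, mul_comm x]

theorem measurableSet_cell (k : ℕ) (i : ℤ) : MeasurableSet (cell k i) := by
  rw [cell_eq_Ico]; exact measurableSet_Ico

theorem volume_cell (k : ℕ) (i : ℤ) : volume (cell k i) = (1 / 2) ^ k := by
  rw [cell_eq_Ico, Real.volume_Ico, ← sub_div, add_sub_cancel_left]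
  rw [ENNReal.ofReal_div_of_pos (by positivity), ENNReal.ofReal_pow (by norm_num)]
  simp [ENNReal.inv_pow]

theorem ediam_cell_le (k : ℕ) (i : ℤ) : Metric.ediam (cell k i) ≤ (1 / 2) ^ k := by
  rw [← volume_cell k i, cell_eq_Ico, Real.volume_Ico]
  refine Metric.ediam_le fun x hx y hy => ?_
  rw [edist_dist, Real.dist_eq]
  exact ENNReal.ofReal_le_ofReal (abs_le.2 ⟨by linarith [hx.1, hy.2], by linarith [hx.2, hy.1]⟩)

theorem floor_two_pow_congr {j k : ℕ} (hjk : j ≤ k) {x y : ℝ} (h : ⌊2 ^ k * x⌋ = ⌊2 ^ k * y⌋) :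
    ⌊2 ^ j * x⌋ = ⌊2 ^ j * y⌋ := by
  obtain ⟨d, rfl⟩ := Nat.exists_eq_add_of_le hjk
  have e : ∀ z : ℝ, 2 ^ j * z = 2 ^ (j + d) * z / ((2 ^ d : ℕ) : ℝ) := fun z => by
    push_cast
    rw [pow_add]
    field_simp
  rw [e x, e y, Int.floor_div_natCast, Int.floor_div_natCast, h]

theorem floor_two_pow_succ (j : ℕ) (x : ℝ) :
    ⌊2 ^ (j + 1) * x⌋ = 2 * ⌊2 ^ j * x⌋ ∨ ⌊2 ^ (j + 1) * x⌋ = 2 * ⌊2 ^ j * x⌋ + 1 := by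
  have h1 := Int.floor_le (2 ^ j * x)
  have h2 := Int.lt_floor_add_one (2 ^ j * x)
  have e : (2 : ℝ) ^ (j + 1) * x = 2 * (2 ^ j * x) := by ring
  rw [e, Int.floor_eq_iff, Int.floor_eq_iff]
  push_cast
  rcases lt_or_ge (2 * (2 ^ j * x)) (2 * (⌊2 ^ j * x⌋ : ℝ) + 1) with h | h
  · exact Or.inl ⟨by linarith, h⟩
  · exact Or.inr ⟨h, by linarith⟩

/-- A Frostman-type measure adapted to the dyadic intervals of length at least `2^{-(j+d)}`: it is
carried by the intervals of this smallest length that meet `U`, and its total mass bounds the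
`α`-dimensional size of a covering of `U`, where `w = 2^{-α}`. -/
theorem exists_dyadic_frostman {w : ℝ≥0∞} (hw1 : w ≤ 1) (hw2 : 1 / 2 ≤ w) (U : Set ℝ) (d : ℕ) :
    ∀ (j : ℕ) (i : ℤ), ∃ (μ : Measure ℝ) (𝒞 : Finset (ℕ × ℤ)),
      μ (cell j i)ᶜ = 0 ∧ (∀ k l, μ (cell k l) ≤ w ^ k) ∧
      (∀ᵐ y ∂μ, ∃ x ∈ cell j i ∩ U, ⌊2 ^ (j + d) * y⌋ = ⌊2 ^ (j + d) * x⌋) ∧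
      cell j i ∩ U ⊆ ⋃ p ∈ 𝒞, cell p.1 p.2 ∧ ∑ p ∈ 𝒞, w ^ p.1 ≤ μ univ := by
  have hw0 : w ≠ 0 := fun h => by rw [h] at hw2; norm_num at hw2
  have hwt : w ≠ ∞ := ne_top_of_le_ne_top ENNReal.one_ne_top hw1
  have hanti : ∀ {j k : ℕ}, j ≤ k → w ^ k ≤ w ^ j := fun h => pow_le_pow_right_of_le_one' hw1 h
  induction d with
  | zero =>
    intro j i
    rcases (cell j i ∩ U).eq_empty_or_nonempty with he | ⟨x, hx⟩
    · exact ⟨0, ∅, by simp, by simp, by simp, by simp [he], by simp⟩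
    -- Lebesgue measure normalized to mass `w ^ j`; on shorter intervals it satisfies the growth
    -- bound because `1/2 ≤ w`.
    set μ := (w ^ j * 2 ^ j) • volume.restrict (cell j i) with hμ
    have huniv : μ univ = w ^ j := by
      rw [hμ, Measure.smul_apply, Measure.restrict_apply_univ, volume_cell, smul_eq_mul, mul_assoc,
        ← mul_pow, one_div, ENNReal.mul_inv_cancel (by norm_num) (by norm_num), one_pow, mul_one]
    refine ⟨μ, {(j, i)}, ?_, fun k l => ?_, ?_, ?_, ?_⟩
    · rw [hμ, Measure.smul_apply, Measure.restrict_apply (measurableSet_cell j i).compl,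
        compl_inter_self, measure_empty, smul_zero]
    · rcases le_total k j with h | h
      · exact (measure_mono (subset_univ _)).trans (huniv.le.trans (hanti h))
      · obtain ⟨e, rfl⟩ := Nat.exists_eq_add_of_le h
        calc μ (cell (j + e) l) ≤ (w ^ j * 2 ^ j) * volume (cell (j + e) l) := by
              rw [hμ, Measure.smul_apply, smul_eq_mul]
              gcongr
              exact Measure.restrict_le_self
          _ = w ^ j * (2 * (1 / 2)) ^ j * (1 / 2) ^ e := by rw [volume_cell]; ring
          _ ≤ w ^ (j + e) := by
              rw [one_div, ENNReal.mul_inv_cancel (by norm_num) (by norm_num), one_pow, mul_one,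
                pow_add, ← one_div]
              gcongr
    · have : ∀ᵐ y ∂μ, y ∈ cell j i :=
        Measure.ae_smul_measure (ae_restrict_mem (measurableSet_cell j i)) _
      filter_upwards [this] with y hy
      refine ⟨x, hx, ?_⟩
      rw [add_zero, mem_cell.1 hy, mem_cell.1 hx.1]
    · simp only [Finset.mem_singleton, iUnion_iUnion_eq_left]
      exact inter_subset_left
    · rw [Finset.sum_singleton, huniv]
  | succ d ih =>
    intro j i
    obtain ⟨μ₁, 𝒞₁, hs₁, hb₁, hU₁, hc₁, hm₁⟩ := ih (j + 1) (2 * i)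
    obtain ⟨μ₂, 𝒞₂, hs₂, hb₂, hU₂, hc₂, hm₂⟩ := ih (j + 1) (2 * i + 1)
    have hsplit : cell j i = cell (j + 1) (2 * i) ∪ cell (j + 1) (2 * i + 1) := by
      ext x
      simp only [mem_union, mem_cell]
      rcases floor_two_pow_succ j x with h | h <;> rw [h] <;> omega
    set S := μ₁ + μ₂ with hS
    have hSs : S (cell j i)ᶜ = 0 := by
      rw [hS, Measure.add_apply, hsplit, compl_union]
      rw [measure_mono_null inter_subset_left hs₁, measure_mono_null inter_subset_right hs₂,
        add_zero]
    have hfar : ∀ {μ : Measure ℝ} {k : ℕ} {l l' : ℤ} {y : ℝ}, j + 1 ≤ k → μ (cell (j + 1) l')ᶜ = 0 →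
        y ∈ cell k l → ⌊2 ^ (j + 1) * y⌋ ≠ l' → μ (cell k l) = 0 := by
      intro μ k l l' y hk hμ hy hne
      refine measure_mono_null (t := (cell (j + 1) l')ᶜ) (fun x hx => mem_compl fun hx' => hne ?_) hμ
      rw [← mem_cell.1 hx']
      exact floor_two_pow_congr hk ((mem_cell.1 hy).trans (mem_cell.1 hx).symm)
    have hSfine : ∀ k l, j + 1 ≤ k → S (cell k l) ≤ w ^ k := by
      intro k l hk
      rw [hS, Measure.add_apply]
      rcases (cell k l).eq_empty_or_nonempty with he | ⟨y, hy⟩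
      · rw [he, measure_empty, measure_empty, add_zero]; exact zero_le
      by_cases h : ⌊2 ^ (j + 1) * y⌋ = 2 * i
      · rw [hfar hk hs₂ hy (by omega), add_zero]; exact hb₁ k l
      · rw [hfar hk hs₁ hy h, zero_add]; exact hb₂ k l
    have hSU : ∀ᵐ y ∂S, ∃ x ∈ cell j i ∩ U,
        ⌊2 ^ (j + (d + 1)) * y⌋ = ⌊2 ^ (j + (d + 1)) * x⌋ := by
      have e : j + (d + 1) = j + 1 + d := by ring
      rw [hS, ae_add_measure_iff, e]
      constructor
      · filter_upwards [hU₁] with y ⟨x, hx, hxy⟩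
        exact ⟨x, ⟨hsplit ▸ Or.inl hx.1, hx.2⟩, hxy⟩
      · filter_upwards [hU₂] with y ⟨x, hx, hxy⟩
        exact ⟨x, ⟨hsplit ▸ Or.inr hx.1, hx.2⟩, hxy⟩
    -- If the two halves carry at most `w ^ j` in total, keep their sum and unite the covers.
    -- Otherwise scale the sum down to mass exactly `w ^ j` and cover by the single parent interval,
    -- whose cost is the same `w ^ j`.
    rcases le_or_gt (S univ) (w ^ j) with hle | hgt
    · refine ⟨S, 𝒞₁ ∪ 𝒞₂, hSs, fun k l => ?_, hSU, ?_, ?_⟩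
      · rcases le_or_gt (j + 1) k with h | h
        · exact hSfine k l h
        · exact (measure_mono (subset_univ _)).trans (hle.trans (hanti (by omega)))
      · rw [hsplit, union_inter_distrib_right, Finset.set_biUnion_union]
        exact union_subset_union hc₁ hc₂
      · calc ∑ p ∈ 𝒞₁ ∪ 𝒞₂, w ^ p.1
            ≤ ∑ p ∈ 𝒞₁ ∪ 𝒞₂, w ^ p.1 + ∑ p ∈ 𝒞₁ ∩ 𝒞₂, w ^ p.1 := le_self_add
          _ = _ := Finset.sum_union_inter
          _ ≤ _ := add_le_add hm₁ hm₂
    · have hSt : S univ ≠ ∞ := by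
        have h1 : S univ ≤ w ^ (j + 1) + w ^ (j + 1) := by
          have key : ∀ {μ : Measure ℝ} {l : ℤ}, μ (cell (j + 1) l)ᶜ = 0 →
              (∀ k l, μ (cell k l) ≤ w ^ k) → μ univ ≤ w ^ (j + 1) := by
            intro μ l h h'
            rw [← measure_add_measure_compl (measurableSet_cell (j + 1) l), h, add_zero]
            exact h' _ _
          exact add_le_add (key hs₁ hb₁) (key hs₂ hb₂)
        exact ne_top_of_le_ne_top (ENNReal.add_ne_top.2
          ⟨ENNReal.pow_ne_top hwt, ENNReal.pow_ne_top hwt⟩) h1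
      have hS0 : S univ ≠ 0 := (zero_le.trans_lt hgt).ne'
      set c := w ^ j / S univ with hc
      have hc1 : c ≤ 1 := ENNReal.div_le_of_le_mul (by rw [one_mul]; exact hgt.le)
      have hcu : (c • S) univ = w ^ j := by
        rw [Measure.smul_apply, smul_eq_mul, hc, ENNReal.div_mul_cancel hS0 hSt]
      refine ⟨c • S, {(j, i)}, ?_, fun k l => ?_, Measure.ae_smul_measure hSU _, ?_, ?_⟩
      · rw [Measure.smul_apply, hSs, smul_zero]
      · rcases le_or_gt (j + 1) k with h | h
        · rw [Measure.smul_apply, smul_eq_mul]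
          exact (mul_le_of_le_one_left zero_le hc1).trans (hSfine k l h)
        · exact (measure_mono (subset_univ _)).trans (hcu.le.trans (hanti (by omega)))
      · simp only [Finset.mem_singleton, iUnion_iUnion_eq_left]
        exact inter_subset_left
      · rw [Finset.sum_singleton, hcu]

/-! ### Truncated solutions -/

variable {m θ κ : ℝ} {f : Lp ℂ 2 (volume : Measure ℝ)}

theorem measurable_hat (f : Lp ℂ 2 (volume : Measure ℝ)) : Measurable (hat f) :=
  (Lp.stronglyMeasurable _).measurable.comp (measurable_id.div_const _)

theorem memLp_hat (f : Lp ℂ 2 (volume : Measure ℝ)) : MemLp (hat f) 2 := by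
  have hc : (2 * Real.pi)⁻¹ ≠ 0 := by positivity
  have h1 : MemLp (𝓕 f : Lp ℂ 2 (volume : Measure ℝ)) 2
      (Measure.map (fun x : ℝ => (2 * Real.pi)⁻¹ * x) volume) := by
    rw [Real.map_volume_mul_left hc]
    exact (Lp.memLp _).smul_measure ENNReal.ofReal_ne_top
  have := h1.comp_measurePreserving
    ((measurable_const_mul ((2 * Real.pi)⁻¹ : ℝ)).measurePreserving volume)
  refine this.congr_norm (measurable_hat f).aestronglyMeasurable (ae_of_all _ fun x => ?_)
  simp only [hat, Function.comp, div_eq_inv_mul]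

theorem integrableOn_hat (f : Lp ℂ 2 (volume : Measure ℝ)) {S : Set ℝ} (hS : volume S < ∞) :
    IntegrableOn (hat f) S := by
  have : Fact (volume S < ∞) := ⟨hS⟩
  exact ((memLp_hat f).restrict S).integrable (by norm_num)

/-- The oscillating factor `e^{i (y ξ + t |ξ|^m)}`. -/
def wave (m y t ξ : ℝ) : ℂ := Complex.exp (Complex.I * ((y * ξ + t * |ξ| ^ m : ℝ) : ℂ))

theorem norm_wave (m y t ξ : ℝ) : ‖wave m y t ξ‖ = 1 := norm_exp_I_mul_ofReal' _

theorem continuous_wave (hm : 0 < m) :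
    Continuous fun p : ℝ × ℝ × ℝ => wave m p.1 p.2.1 p.2.2 := by
  have : Continuous fun p : ℝ × ℝ × ℝ => |p.2.2| ^ m :=
    (continuous_abs.comp (continuous_snd.comp continuous_snd)).rpow_const fun _ => Or.inr hm.le
  unfold wave
  fun_prop

theorem continuous_wave_right (hm : 0 < m) (y t : ℝ) : Continuous (wave m y t) :=
  (continuous_wave hm).comp (by fun_prop : Continuous fun ξ : ℝ => (y, t, ξ))

theorem integrableOn_wave_mul_hat (hm : 0 < m) (f : Lp ℂ 2 (volume : Measure ℝ)) (y t : ℝ)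
    {S : Set ℝ} (hS : volume S < ∞) : IntegrableOn (fun ξ => wave m y t ξ * hat f ξ) S :=
  (integrableOn_hat f hS).bdd_mul (c := 1) (continuous_wave_right hm y t).aestronglyMeasurable
    (ae_of_all _ fun ξ => (norm_wave m y t ξ).le)

theorem partialSol_eq (m : ℝ) (f : Lp ℂ 2 (volume : Measure ℝ)) (N y t : ℝ) :
    partialSol m f N y t =
      ((2 * Real.pi)⁻¹ : ℝ) * ∫ ξ in Icc (-N) N, wave m y t ξ * hat f ξ := rfl

theorem partialSol_sub (hm : 0 < m) (f : Lp ℂ 2 (volume : Measure ℝ)) {M N : ℝ} (hMN : M ≤ N)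
    (y t : ℝ) : partialSol m f N y t - partialSol m f M y t =
      ((2 * Real.pi)⁻¹ : ℝ) * ∫ ξ in annulus M N, wave m y t ξ * hat f ξ := by
  have hu : Icc (-N) N = Icc (-M) M ∪ annulus M N := by
    ext ξ
    simp only [annulus, mem_union, mem_ofPred_eq, ← abs_le, mem_Icc]
    constructor
    · intro h
      rcases le_or_gt |ξ| M with h' | h'
      · exact Or.inl h'
      · exact Or.inr ⟨h', h⟩
    · rintro (h | h)
      · exact h.trans hMN
      · exact h.2
  have hd : Disjoint (Icc (-M) M) (annulus M N) := by
    rw [Set.disjoint_left]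
    intro ξ h h'
    exact absurd (abs_le.2 h) (not_le.2 h'.1)
  rw [partialSol_eq, partialSol_eq, hu, setIntegral_union hd (measurableSet_annulus _ _)
    (integrableOn_wave_mul_hat hm f y t measure_Icc_lt_top)
    (integrableOn_wave_mul_hat hm f y t (volume_annulus_lt_top _ _))]
  ring

/-- Joint continuity includes the cut-off `N`, because the points with `|ξ| = N` form a null set.
This makes suprema over times and cut-offs measurable and reducible to countable dense families. -/
theorem continuous_partialSol (hm : 0 < m) (f : Lp ℂ 2 (volume : Measure ℝ)) :
    Continuous fun p : ℝ × ℝ × ℝ => partialSol m f p.1 p.2.1 p.2.2 := by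
  simp_rw [partialSol_eq]
  refine continuous_const.mul ?_
  simp_rw [← integral_indicator measurableSet_Icc]
  rw [continuous_iff_continuousAt]
  rintro ⟨N, y, t⟩
  refine continuousAt_of_dominated
    (bound := fun ξ => (Icc (-(N + 1)) (N + 1)).indicator (fun ξ => ‖hat f ξ‖) ξ) ?_ ?_ ?_ ?_
  · refine Eventually.of_forall fun p => ?_
    exact ((((continuous_wave_right hm _ _).measurable).mul (measurable_hat f)).indicator
      measurableSet_Icc).aestronglyMeasurable
  · have : ∀ᶠ p : ℝ × ℝ × ℝ in 𝓝 (N, y, t), p.1 < N + 1 :=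
      continuousAt_fst.eventually (eventually_lt_nhds (by simp : (N, y, t).1 < N + 1))
    filter_upwards [this] with p hp
    refine ae_of_all _ fun ξ => ?_
    rw [norm_indicator_eq_indicator_norm]
    simp only [norm_mul, norm_wave, one_mul]
    exact indicator_le_indicator_of_subset (Icc_subset_Icc (by linarith) hp.le)
      (fun _ => norm_nonneg _) ξ
  · rw [integrable_indicator_iff measurableSet_Icc]
    exact (integrableOn_hat f measure_Icc_lt_top).norm
  · have hne : ∀ᵐ ξ : ℝ, |ξ| ≠ N := by
      have : ({N, -N} : Set ℝ).Countable := by simp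
      filter_upwards [this.ae_notMem volume] with ξ hξ h
      apply hξ
      rcases abs_choice ξ with h' | h'
      · left; rw [← h, h']
      · right; rw [mem_singleton_iff, ← h, h', neg_neg]
    filter_upwards [hne] with ξ hξ
    have hc : ContinuousAt (fun p : ℝ × ℝ × ℝ => wave m p.2.1 p.2.2 ξ * hat f ξ) (N, y, t) :=
      (((continuous_wave hm).comp (by fun_prop :
        Continuous fun p : ℝ × ℝ × ℝ => (p.2.1, p.2.2, ξ))).mul continuous_const).continuousAt
    rcases lt_or_gt_of_ne hξ with h | h
    · refine hc.congr ?_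
      filter_upwards [continuousAt_fst.eventually (eventually_gt_nhds
        (by simpa using h : |ξ| < (N, y, t).1))] with p hp
      rw [indicator_of_mem (show ξ ∈ Icc (-p.1) p.1 from abs_le.1 hp.le)]
    · refine (continuousAt_const (y := (0 : ℂ))).congr ?_
      filter_upwards [continuousAt_fst.eventually (eventually_lt_nhds
        (by simpa using h : (N, y, t).1 < |ξ|))] with p hp
      rw [indicator_of_notMem]
      exact fun h' => absurd (abs_le.2 h') (not_le.2 hp)

theorem continuous_curve (hκ : 1 ≤ κ) : Continuous fun p : ℝ × ℝ => curve θ κ p.1 p.2 := by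
  have : Continuous fun p : ℝ × ℝ => p.2 ^ κ := continuous_snd.rpow_const fun _ => Or.inr (by linarith)
  unfold curve
  fun_prop

/-! ### Linearization of the maximal function -/

/-- The time and the cut-off are arbitrary measurable functions of `x`. The cut-off enters the `TT*`
kernel only through `min (N x) (N y)`, and the oscillatory bound is uniform in the upper end of the
annulus. -/
theorem exists_lintegral_linearized_le {b : ℝ} (hm : m ∈ Ioo (0 : ℝ) 1) (hκ : 1 ≤ κ) (hθ : 0 < θ)
    (hb0 : 0 < b) (hb : b ≤ 1 / 2) :
    ∃ C : ℝ≥0, ∀ (f : Lp ℂ 2 (volume : Measure ℝ)) (lam : ℝ) (t N : ℝ → ℝ) (ν : Measure ℝ)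
      (V : ℝ≥0∞), 1 ≤ lam → Measurable t → Measurable N → (∀ x, |t x| ≤ 1) →
      (∀ x, N x ≤ 2 * lam) → IsFiniteMeasure ν → (∀ x, ∫⁻ y, ‖x - y‖ₑ ^ (-b) ∂ν ≤ V) →
      ∫⁻ x, ‖∫ ξ in annulus lam (N x), wave m (curve θ κ x (t x)) (t x) ξ * hat f ξ‖ₑ ^ 2 ∂ν ≤
        C * V * ENNReal.ofReal (lam ^ (1 - m * b)) *
          ∫⁻ ξ in annulus lam (2 * lam), ‖hat f ξ‖ₑ ^ 2 := by
  obtain ⟨C, hC, hosc⟩ := exists_norm_annulus_integral_le (L := θ * κ) hm (by positivity) hb0.le hb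
  refine ⟨2 * C.toNNReal, fun f lam t N ν V hlam ht hN ht1 hN1 hν hV => ?_⟩
  have hlam0 : 0 < lam := by linarith
  set S := annulus lam (2 * lam) with hS
  have hSf : IsFiniteMeasure (volume.restrict S) :=
    ⟨by rw [Measure.restrict_apply_univ]; exact volume_annulus_lt_top _ _⟩
  set E : ℝ → ℝ → ℂ := fun x ξ =>
    (annulus lam (N x)).indicator (wave m (curve θ κ x (t x)) (t x)) ξ with hEdef
  have hsub : ∀ x, annulus lam (N x) ⊆ S := fun x ξ h => ⟨h.1, h.2.trans (hN1 x)⟩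
  have hEm : Measurable (Function.uncurry E) := by
    have : Function.uncurry E = indicator {p : ℝ × ℝ | lam < |p.2| ∧ |p.2| ≤ N p.1}
        (fun p => wave m (curve θ κ p.1 (t p.1)) (t p.1) p.2) := by
      ext p
      rfl
    rw [this]
    refine Measurable.indicator ?_ ?_
    · exact (continuous_wave hm.1).measurable.comp
        ((((continuous_curve hκ).measurable.comp
          (measurable_fst.prodMk (ht.comp measurable_fst)))).prodMk
            ((ht.comp measurable_fst).prodMk measurable_snd))
    · exact (measurableSet_lt measurable_const measurable_snd.norm).inter
        (measurableSet_le measurable_snd.norm (hN.comp measurable_fst))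
  have hE1 : ∀ x ξ, ‖E x ξ‖ ≤ 1 := fun x ξ =>
    (norm_indicator_le_norm_self _ _).trans (norm_wave _ _ _ _).le
  set D : ℝ≥0∞ := ENNReal.ofReal (C * lam ^ (1 - m * b)) with hD
  have hD0 : D ≠ 0 := by
    rw [hD, Ne, ENNReal.ofReal_eq_zero, not_le]
    positivity
  have key := lintegral_sq_le_of_kernel (ν := ν) (σ := volume.restrict S) (E := E) hEm hE1
    (measurable_hat f) (integrableOn_hat f (volume_annulus_lt_top _ _))
    (k := fun x y => D * ‖x - y‖ₑ ^ (-b))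
    (((measurable_fst.sub measurable_snd).enorm.pow_const _).const_mul _)
    (fun x y => by simp only [enorm_sub_rev]) (fun x y => ?_) (B := D * V) (fun x => by
      rw [lintegral_const_mul _ (by fun_prop : Measurable fun y : ℝ => ‖x - y‖ₑ ^ (-b))]
      gcongr
      exact hV x)
  · refine le_trans (le_of_eq ?_) (key.trans (le_of_eq ?_))
    · refine lintegral_congr fun x => ?_
      congr 2
      rw [← integral_indicator (measurableSet_annulus _ _),
        ← integral_indicator (measurableSet_annulus _ _)]
      congr 1
      ext ξ
      by_cases h : ξ ∈ annulus lam (N x)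
      · rw [indicator_of_mem h, indicator_of_mem (hsub x h), hEdef]
        simp only [indicator_of_mem h]
      · rw [indicator_of_notMem h]
        by_cases h' : ξ ∈ S
        · rw [indicator_of_mem h', hEdef]
          simp only [indicator_of_notMem h, zero_mul]
        · rw [indicator_of_notMem h']
    · rw [hD, ENNReal.ofReal_mul hC.le]
      push_cast
      rw [ENNReal.ofReal]
      ring
  -- On the diagonal the majorant is `∞`, since `b > 0` and `D ≠ 0`.
  · rcases eq_or_ne x y with rfl | hxy
    · simp only [sub_self, enorm_zero]
      rw [ENNReal.zero_rpow_of_neg (by linarith), ENNReal.mul_top hD0]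
      exact le_top
    have hr : x - y ≠ 0 := sub_ne_zero.2 hxy
    have e1 : ∫ ξ in S, E x ξ * starRingEnd ℂ (E y ξ) =
        ∫ ξ in annulus lam (min (N x) (N y)), Complex.exp (Complex.I *
          (((curve θ κ x (t x) - curve θ κ y (t y)) * ξ + (t x - t y) * |ξ| ^ m : ℝ) : ℂ)) := by
      rw [← integral_indicator (measurableSet_annulus _ _),
        ← integral_indicator (measurableSet_annulus _ _)]
      congr 1
      ext ξ
      by_cases h : ξ ∈ annulus lam (min (N x) (N y))
      · have hx : ξ ∈ annulus lam (N x) := ⟨h.1, h.2.trans (min_le_left _ _)⟩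
        have hy : ξ ∈ annulus lam (N y) := ⟨h.1, h.2.trans (min_le_right _ _)⟩
        rw [indicator_of_mem h, indicator_of_mem (hsub x hx), hEdef]
        simp only [indicator_of_mem hx, indicator_of_mem hy, wave]
        rw [← Complex.exp_conj, ← Complex.exp_add]
        congr 1
        simp only [map_mul, Complex.conj_I, Complex.conj_ofReal]
        push_cast
        ring
      · rw [indicator_of_notMem h]
        by_cases h' : ξ ∈ S
        · rw [indicator_of_mem h', hEdef]
          simp only
          by_cases hx : ξ ∈ annulus lam (N x)
          · have hy : ξ ∉ annulus lam (N y) := fun hy => h ⟨hx.1, le_min hx.2 hy.2⟩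
            rw [indicator_of_notMem hy, map_zero, mul_zero]
          · rw [indicator_of_notMem hx, zero_mul]
        · rw [indicator_of_notMem h']
    rw [e1]
    have h2 := hosc lam (min (N x) (N y)) (x - y) (t x - t y)
      (curve θ κ x (t x) - curve θ κ y (t y)) hlam ((min_le_left _ _).trans (hN1 x)) hr (by
        have : curve θ κ x (t x) - curve θ κ y (t y) - (x - y) =
          -(θ * (t x ^ κ - t y ^ κ)) := by unfold curve; ring
        rw [this, abs_neg, abs_mul, abs_of_pos hθ, mul_assoc]
        exact mul_le_mul_of_nonneg_left (abs_rpow_sub_rpow_le hκ (ht1 x) (ht1 y)) hθ.le)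
    rw [← ofReal_norm, ← ofReal_norm, Real.norm_eq_abs,
      ENNReal.ofReal_rpow_of_pos (abs_pos.2 hr), hD, ← ENNReal.ofReal_mul (by positivity)]
    exact ENNReal.ofReal_le_ofReal (by rw [mul_assoc]; exact h2)

/-- Among finitely many points of a dense sequence a maximizing parameter can be chosen measurably
in `x`. Fatou's lemma and continuity in the parameter pass to the full supremum. -/
theorem lintegral_iSup_sq_le {X P : Type*} [MeasurableSpace X] [TopologicalSpace P]
    [MeasurableSpace P] [Nonempty P] [TopologicalSpace.SeparableSpace P]
    {G : X → P → ℂ} (hG : Measurable (Function.uncurry G)) (hGc : ∀ x, Continuous (G x))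
    {ν : Measure X} {B : ℝ≥0∞}
    (hB : ∀ p : X → P, Measurable p → ∫⁻ x, ‖G x (p x)‖ₑ ^ 2 ∂ν ≤ B) :
    ∫⁻ x, (⨆ p, ‖G x p‖ₑ) ^ 2 ∂ν ≤ B := by
  set d := TopologicalSpace.denseSeq P with hd
  have hsel : ∀ K : ℕ, ∃ p : X → P, Measurable p ∧ ∀ x, ∀ i ≤ K, ‖G x (d i)‖ₑ ≤ ‖G x (p x)‖ₑ := by
    intro K
    induction K with
    | zero =>
      refine ⟨fun _ => d 0, measurable_const, fun x i hi => ?_⟩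
      rw [Nat.le_zero.1 hi]
    | succ K ih =>
      obtain ⟨p, hp, h⟩ := ih
      classical
      refine ⟨fun x => if ‖G x (p x)‖ₑ ≤ ‖G x (d (K + 1))‖ₑ then d (K + 1) else p x,
        Measurable.ite (measurableSet_le (hG.comp (measurable_id.prodMk hp)).enorm
          (hG.comp (measurable_id.prodMk measurable_const)).enorm) measurable_const hp,
        fun x i hi => ?_⟩
      simp only
      split_ifs with hc
      · rcases hi.lt_or_eq with h' | h'
        · exact (h x i (Nat.lt_succ_iff.1 h')).trans hc
        · rw [h']
      · rcases hi.lt_or_eq with h' | h'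
        · exact h x i (Nat.lt_succ_iff.1 h')
        · rw [h']; exact (not_le.1 hc).le
  choose p hp hle using hsel
  calc ∫⁻ x, (⨆ p, ‖G x p‖ₑ) ^ 2 ∂ν
      ≤ ∫⁻ x, liminf (fun K => ‖G x (p K x)‖ₑ ^ 2) atTop ∂ν := by
        refine lintegral_mono fun x => ?_
        set l := liminf (fun K => ‖G x (p K x)‖ₑ ^ 2) atTop with hl
        have hden : ∀ q : P, ‖G x q‖ₑ ^ 2 ≤ l := by
          intro q
          have hcl : IsClosed {q : P | ‖G x q‖ₑ ^ 2 ≤ l} :=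
            isClosed_le ((ENNReal.continuous_pow 2).comp (hGc x).enorm) continuous_const
          have hsub : range d ⊆ {q : P | ‖G x q‖ₑ ^ 2 ≤ l} := by
            rintro _ ⟨i, rfl⟩
            change ‖G x (d i)‖ₑ ^ 2 ≤ l
            refine le_liminf_of_le (by isBoundedDefault) ?_
            filter_upwards [eventually_ge_atTop i] with K hK
            gcongr
            exact hle K x i hK
          have := hcl.closure_subset_iff.2 hsub
          rw [(TopologicalSpace.denseRange_denseSeq P).closure_eq] at this
          exact this (mem_univ q)
        have h2 : (⨆ p, ‖G x p‖ₑ) ≤ l ^ (1 / 2 : ℝ) := by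
          refine iSup_le fun q => ?_
          have := ENNReal.rpow_le_rpow (hden q) (by norm_num : (0 : ℝ) ≤ 1 / 2)
          rwa [← ENNReal.rpow_two, ← ENNReal.rpow_mul, mul_one_div_cancel (by norm_num),
            ENNReal.rpow_one] at this
        calc _ ≤ (l ^ (1 / 2 : ℝ)) ^ 2 := by gcongr
          _ = l := by
            rw [← ENNReal.rpow_two, ← ENNReal.rpow_mul, one_div_mul_cancel (by norm_num),
              ENNReal.rpow_one]
    _ ≤ liminf (fun K => ∫⁻ x, ‖G x (p K x)‖ₑ ^ 2 ∂ν) atTop :=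
        lintegral_liminf_le fun K => (hG.comp (measurable_id.prodMk (hp K))).enorm.pow_const 2
    _ ≤ B := by
        refine (liminf_le_liminf (v := fun _ => B) (Eventually.of_forall fun K => hB _ (hp K))).trans ?_
        simp

/-! ### Maximal functions of dyadic blocks -/

/-- Times in `[-1, 1]` and truncation frequencies in `[2^n, 2^(n+1)]`. -/
abbrev BlockParams (n : ℕ) : Type := Icc (-1 : ℝ) 1 × Icc ((2 : ℝ) ^ n) (2 ^ (n + 1))

instance (n : ℕ) : Nonempty (BlockParams n) :=
  ⟨⟨⟨0, by norm_num⟩, ⟨2 ^ n, le_rfl, pow_le_pow_right₀ (by norm_num) (Nat.le_succ n)⟩⟩⟩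

/-- The contribution to the solution along the curve of the frequencies `2^n < |ξ| ≤ N`. -/
def increment (m θ κ : ℝ) (f : Lp ℂ 2 (volume : Measure ℝ)) (n : ℕ) (x : ℝ)
    (p : BlockParams n) : ℂ :=
  partialSol m f p.2 (curve θ κ x p.1) p.1 - partialSol m f (2 ^ n) (curve θ κ x p.1) p.1

/-- The maximal function of the `n`th dyadic frequency block along the curve. -/
def blockSup (m θ κ : ℝ) (f : Lp ℂ 2 (volume : Measure ℝ)) (n : ℕ) (x : ℝ) : ℝ≥0∞ :=
  ⨆ p : BlockParams n, ‖increment m θ κ f n x p‖ₑ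

theorem continuous_increment (hm : 0 < m) (hκ : 1 ≤ κ) (f : Lp ℂ 2 (volume : Measure ℝ)) (n : ℕ) :
    Continuous (Function.uncurry (increment m θ κ f n)) := by
  have hc : Continuous fun z : ℝ × BlockParams n => curve θ κ z.1 z.2.1 :=
    (continuous_curve hκ).comp (by fun_prop : Continuous fun z : ℝ × BlockParams n =>
      (z.1, (z.2.1 : ℝ)))
  have h := continuous_partialSol hm f
  refine Continuous.sub (h.comp (g := fun p : ℝ × ℝ × ℝ => partialSol m f p.1 p.2.1 p.2.2)
    (f := fun z : ℝ × BlockParams n => ((z.2.2 : ℝ), curve θ κ z.1 z.2.1, (z.2.1 : ℝ))) ?_)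
    (h.comp (g := fun p : ℝ × ℝ × ℝ => partialSol m f p.1 p.2.1 p.2.2)
    (f := fun z : ℝ × BlockParams n => ((2 : ℝ) ^ n, curve θ κ z.1 z.2.1, (z.2.1 : ℝ))) ?_)
  · fun_prop
  · fun_prop

theorem measurable_blockSup (hm : 0 < m) (hκ : 1 ≤ κ) (f : Lp ℂ 2 (volume : Measure ℝ)) (n : ℕ) :
    Measurable (blockSup m θ κ f n) :=
  LowerSemicontinuous.measurable <| lowerSemicontinuous_iSup fun p =>
    ((continuous_increment hm hκ f n).comp
      (Continuous.prodMk_left p)).enorm.lowerSemicontinuous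

theorem enorm_increment_le (hm : 0 < m) (n : ℕ) (x : ℝ) (p : BlockParams n) :
    ‖increment m θ κ f n x p‖ₑ ≤
      ‖∫ ξ in annulus (2 ^ n) p.2, wave m (curve θ κ x p.1) p.1 ξ * hat f ξ‖ₑ := by
  have h2 : ‖(((2 * Real.pi)⁻¹ : ℝ) : ℂ)‖ ≤ 1 := by
    rw [Complex.norm_real, Real.norm_of_nonneg (by positivity)]
    exact inv_le_one_of_one_le₀ (by linarith [Real.pi_gt_three])
  rw [increment, partialSol_sub hm f p.2.2.1, ← ofReal_norm, ← ofReal_norm]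
  refine ENNReal.ofReal_le_ofReal ?_
  rw [norm_mul]
  exact mul_le_of_le_one_left (norm_nonneg _) h2

theorem hsNorm_sq (s : ℝ) (f : Lp ℂ 2 (volume : Measure ℝ)) : hsNorm s f ^ 2 =
    ENNReal.ofReal (2 * Real.pi)⁻¹ *
      ∫⁻ ξ : ℝ, ENNReal.ofReal ((1 + ξ ^ 2) ^ s) * ‖hat f ξ‖ₑ ^ 2 := by
  rw [hsNorm, ← ENNReal.rpow_two, ← ENNReal.rpow_mul, one_div_mul_cancel (by norm_num),
    ENNReal.rpow_one]

theorem lintegral_weight_eq (s : ℝ) (f : Lp ℂ 2 (volume : Measure ℝ)) :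
    ∫⁻ ξ : ℝ, ENNReal.ofReal ((1 + ξ ^ 2) ^ s) * ‖hat f ξ‖ₑ ^ 2 =
      ENNReal.ofReal (2 * Real.pi) * hsNorm s f ^ 2 := by
  rw [hsNorm_sq, ← mul_assoc, ← ENNReal.ofReal_mul (by positivity),
    mul_inv_cancel₀ (by positivity), ENNReal.ofReal_one, one_mul]

theorem lintegral_annulus_hat_le {s lam : ℝ} (hs : 0 ≤ s) (hlam : 0 < lam) (c : ℝ)
    (f : Lp ℂ 2 (volume : Measure ℝ)) :
    ∫⁻ ξ in annulus lam c, ‖hat f ξ‖ₑ ^ 2 ≤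
      ENNReal.ofReal (lam ^ (-(2 * s))) * (ENNReal.ofReal (2 * Real.pi) * hsNorm s f ^ 2) := by
  rw [← lintegral_weight_eq, ← lintegral_const_mul' _ _ ENNReal.ofReal_ne_top]
  refine le_trans ?_ (setLIntegral_le_lintegral (annulus lam c) _)
  refine setLIntegral_mono' (measurableSet_annulus _ _) fun ξ hξ => ?_
  rw [← mul_assoc, ← ENNReal.ofReal_mul (by positivity)]
  refine le_mul_of_one_le_left zero_le ?_
  rw [ENNReal.one_le_ofReal]
  have h1 : lam ^ (2 * s) ≤ (1 + ξ ^ 2) ^ s := by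
    rw [Real.rpow_mul hlam.le, Real.rpow_two]
    refine Real.rpow_le_rpow (by positivity) ?_ hs
    have : lam ^ 2 ≤ |ξ| ^ 2 := pow_le_pow_left₀ hlam.le hξ.1.le 2
    rw [sq_abs] at this
    linarith
  rw [Real.rpow_neg hlam.le]
  have : 0 < lam ^ (2 * s) := by positivity
  rw [inv_mul_eq_div, le_div_iff₀ this]
  linarith

/-- The kernel costs `2^((1-mb)n)` and the Sobolev weight on the annulus gains `2^(-2sn)`. The
bounds decay geometrically exactly when `2s > 1 - mb`. -/
theorem exists_lintegral_blockSup_sq_le {b : ℝ} (hm : m ∈ Ioo (0 : ℝ) 1) (hκ : 1 ≤ κ) (hθ : 0 < θ)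
    (hb0 : 0 < b) (hb : b ≤ 1 / 2) :
    ∃ C : ℝ≥0, ∀ (s : ℝ) (f : Lp ℂ 2 (volume : Measure ℝ)) (n : ℕ) (ν : Measure ℝ)
      (V : ℝ≥0∞), 0 ≤ s → IsFiniteMeasure ν → (∀ x, ∫⁻ y, ‖x - y‖ₑ ^ (-b) ∂ν ≤ V) →
      ∫⁻ x, blockSup m θ κ f n x ^ 2 ∂ν ≤
        C * V * ENNReal.ofReal ((2 ^ (1 - m * b - 2 * s)) ^ n) * hsNorm s f ^ 2 := by
  obtain ⟨C, hC⟩ := exists_lintegral_linearized_le (θ := θ) hm hκ hθ hb0 hb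
  refine ⟨C * (2 * Real.pi).toNNReal, fun s f n ν V hs hν hV => ?_⟩
  have hcont := continuous_increment (θ := θ) hm.1 hκ f n
  refine lintegral_iSup_sq_le hcont.measurable
    (fun x => hcont.comp (Continuous.prodMk_right x)) fun p hp => ?_
  have h2 : (1 : ℝ) ≤ 2 ^ n := one_le_pow₀ (by norm_num)
  calc ∫⁻ x, ‖increment m θ κ f n x (p x)‖ₑ ^ 2 ∂ν
      ≤ ∫⁻ x, ‖∫ ξ in annulus (2 ^ n) (p x).2,
          wave m (curve θ κ x (p x).1) (p x).1 ξ * hat f ξ‖ₑ ^ 2 ∂ν := by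
        gcongr with x
        exact enorm_increment_le hm.1 n x (p x)
    _ ≤ C * V * ENNReal.ofReal ((2 ^ n) ^ (1 - m * b)) *
          ∫⁻ ξ in annulus (2 ^ n) (2 * 2 ^ n), ‖hat f ξ‖ₑ ^ 2 :=
        hC f (2 ^ n) (fun x => (p x).1) (fun x => (p x).2) ν V h2
          (measurable_subtype_coe.comp (measurable_fst.comp hp))
          (measurable_subtype_coe.comp (measurable_snd.comp hp))
          (fun x => abs_le.2 (p x).1.2)
          (fun x => (p x).2.2.2.trans (le_of_eq (by ring))) hν hV
    _ ≤ C * V * ENNReal.ofReal ((2 ^ n) ^ (1 - m * b)) * (ENNReal.ofReal ((2 ^ n) ^ (-(2 * s))) *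
          (ENNReal.ofReal (2 * Real.pi) * hsNorm s f ^ 2)) := by
        gcongr
        exact lintegral_annulus_hat_le hs (by positivity) _ f
    _ = _ := by
        have : ((2 : ℝ) ^ (1 - m * b - 2 * s)) ^ n =
            (2 ^ n) ^ (1 - m * b) * (2 ^ n) ^ (-(2 * s)) := by
          rw [← Real.rpow_add (by positivity), ← Real.rpow_natCast, ← Real.rpow_natCast,
            ← Real.rpow_mul (by norm_num), ← Real.rpow_mul (by norm_num)]
          ring_nf
        rw [this, ENNReal.ofReal_mul (p := (2 ^ n) ^ (1 - m * b)) (by positivity)]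
        rw [ENNReal.coe_mul, ENNReal.ofNNReal_toNNReal]
        ring

/-! ### From summable blocks to pointwise convergence -/

theorem edist_partialSol_le (n : ℕ) (x : ℝ) {t N : ℝ} (ht : |t| ≤ 1)
    (hN : N ∈ Icc ((2 : ℝ) ^ n) (2 ^ (n + 1))) :
    edist (partialSol m f N (curve θ κ x t) t) (partialSol m f (2 ^ n) (curve θ κ x t) t) ≤
      blockSup m θ κ f n x := by
  rw [edist_eq_enorm_sub]
  exact le_iSup (fun p : BlockParams n => ‖increment m θ κ f n x p‖ₑ) (⟨t, abs_le.1 ht⟩, ⟨N, hN⟩)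

/-- The block maximal function controls both the jump between consecutive dyadic cut-offs and the
oscillation at intermediate ones, so convergence holds along all real `N`. The tail bound does not
depend on `t`. -/
theorem tendsto_partialSol_sol {x t : ℝ} (ht : |t| ≤ 1)
    (hx : ∑' n, blockSup m θ κ f n x ≠ ∞) :
    Tendsto (fun N => partialSol m f N (curve θ κ x t) t) atTop (𝓝 (sol m f (curve θ κ x t) t)) ∧
    ∀ n : ℕ, edist (partialSol m f (2 ^ n) (curve θ κ x t) t) (sol m f (curve θ κ x t) t) ≤
      ∑' k, blockSup m θ κ f (n + k) x := by
  have h2 : ∀ n : ℕ, (2 : ℝ) ^ n ≤ 2 ^ (n + 1) := fun n =>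
    pow_le_pow_right₀ (by norm_num) (Nat.le_succ n)
  have hstep : ∀ n : ℕ, edist (partialSol m f (2 ^ n) (curve θ κ x t) t)
      (partialSol m f (2 ^ (n + 1)) (curve θ κ x t) t) ≤ blockSup m θ κ f n x := fun n => by
    rw [edist_comm]
    exact edist_partialSol_le n x ht ⟨h2 n, le_rfl⟩
  obtain ⟨c, hc⟩ := cauchySeq_tendsto_of_complete
    (cauchySeq_of_edist_le_of_tsum_ne_top _ hstep hx)
  have htail := edist_le_tsum_of_edist_le_of_tendsto _ hstep hc
  have hmain : Tendsto (fun N => partialSol m f N (curve θ κ x t) t) atTop (𝓝 c) := by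
    rw [EMetric.tendsto_nhds]
    intro ε hε
    have h0 := ENNReal.tendsto_sum_nat_add (fun n => blockSup m θ κ f n x) hx
    have hε2 : 0 < ε / 2 := ENNReal.half_pos hε.ne'
    obtain ⟨n0, hn0⟩ := ((ENNReal.tendsto_nhds_zero.1 h0 (ε / 2 / 2)
      (ENNReal.half_pos hε2.ne')).and (eventually_ge_atTop 0)).exists
    rcases eq_or_ne ε ∞ with rfl | hεt
    · exact Eventually.of_forall fun N => edist_lt_top _ _
    filter_upwards [eventually_ge_atTop ((2 : ℝ) ^ n0)] with N hN
    obtain ⟨n, hn1, hn2⟩ := exists_nat_pow_near (one_le_pow₀ (by norm_num) |>.trans hN)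
      (by norm_num : (1 : ℝ) < 2)
    have hnn : n0 ≤ n := by
      have : (2 : ℝ) ^ n0 < 2 ^ (n + 1) := hN.trans_lt hn2
      exact Nat.lt_succ_iff.1 ((pow_lt_pow_iff_right₀ (by norm_num)).1 this)
    have hmono : ∑' k, blockSup m θ κ f (n + k) x ≤ ∑' k, blockSup m θ κ f (k + n0) x := by
      obtain ⟨j, rfl⟩ := Nat.exists_eq_add_of_le hnn
      have : ∀ k, n0 + j + k = (j + k) + n0 := fun k => by ring
      simp_rw [this]
      exact ENNReal.tsum_comp_le_tsum_of_injective (f := fun k => j + k)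
        (add_right_injective j) (fun k => blockSup m θ κ f (k + n0) x)
    have hfirst : blockSup m θ κ f n x ≤ ∑' k, blockSup m θ κ f (n + k) x := by
      simpa using ENNReal.le_tsum (f := fun k => blockSup m θ κ f (n + k) x) 0
    calc edist (partialSol m f N (curve θ κ x t) t) c
        ≤ _ := edist_triangle _ (partialSol m f (2 ^ n) (curve θ κ x t) t) _
      _ ≤ ε / 2 / 2 + ε / 2 / 2 := add_le_add
          ((edist_partialSol_le n x ht ⟨hn1, hn2.le⟩).trans (hfirst.trans (hmono.trans hn0.1)))
          ((htail n).trans (hmono.trans hn0.1))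
      _ = ε / 2 := ENNReal.add_halves _
      _ < ε := ENNReal.half_lt_self hε.ne' hεt
  have : sol m f (curve θ κ x t) t = c := hmain.limUnder_eq
  rw [this]
  exact ⟨hmain, htail⟩

theorem curve_zero (hκ : 1 ≤ κ) (x : ℝ) : curve θ κ x 0 = x := by
  rw [curve, Real.zero_rpow (by linarith)]; ring

/-- The solution along the curve is a uniform limit of continuous functions of `t` on `[-1, 1]`,
hence continuous at `0`, where the curve passes through `x`. -/
theorem solExists_zero_and_convergesAlong (hm : 0 < m) (hκ : 1 ≤ κ) {x : ℝ}
    (hx : ∑' n, blockSup m θ κ f n x ≠ ∞) :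
    SolExists m f x 0 ∧ ConvergesAlong m θ κ f x (sol m f x 0) := by
  have hsm : ∀ᶠ t : ℝ in 𝓝 0, |t| ≤ 1 := by
    have : ContinuousAt (fun t : ℝ => |t|) 0 := continuous_abs.continuousAt
    exact this.eventually (eventually_le_nhds (by simp))
  refine ⟨?_, ?_, ?_⟩
  · have := (tendsto_partialSol_sol (t := 0) (by simp) hx).1
    rw [curve_zero hκ] at this
    exact ⟨_, this⟩
  · filter_upwards [nhdsWithin_le_nhds hsm] with t ht
    exact ⟨_, (tendsto_partialSol_sol ht hx).1⟩
  · have hu : TendstoUniformlyOn (fun (n : ℕ) t => partialSol m f (2 ^ n) (curve θ κ x t) t)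
        (fun t => sol m f (curve θ κ x t) t) atTop (Icc (-1 : ℝ) 1) := by
      rw [EMetric.tendstoUniformlyOn_iff]
      intro ε hε
      have h0 := ENNReal.tendsto_sum_nat_add (fun n => blockSup m θ κ f n x) hx
      filter_upwards [h0.eventually (eventually_lt_nhds hε)] with n hn t ht
      rw [edist_comm]
      refine ((tendsto_partialSol_sol (abs_le.2 ht) hx).2 n).trans_lt ?_
      simp_rw [add_comm n]
      exact hn
    have hcont := hu.continuousOn (Frequently.of_forall fun n => by
      have h3 : Continuous fun t : ℝ => ((2 : ℝ) ^ n, curve θ κ x t, t) := by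
        have := (continuous_curve (θ := θ) hκ).comp (Continuous.prodMk_right x)
        fun_prop
      exact ((continuous_partialSol hm f).comp h3).continuousOn)
    have h4 := (hcont.continuousAt (x := 0) (Icc_mem_nhds (by norm_num) (by norm_num))).tendsto
    rw [curve_zero hκ] at h4
    exact h4.mono_left nhdsWithin_le_nhds

/-! ### Finiteness of the Sobolev norm -/

/-- Membership in the Sobolev space makes the weighted Fourier transform, as a distribution, an `L²`
function `g`. For `s ≥ 0` the inverse weight is bounded, so multiplying back stays in `L²`, and
injectivity of `L²` into distributions gives the pointwise identity. -/
theorem exists_memLp_weight_fourier {s : ℝ} (hs : 0 ≤ s) (hf : MemHs s f) :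
    ∃ g : Lp ℂ 2 (volume : Measure ℝ), ∀ᵐ x : ℝ,
      ENNReal.ofReal ((1 + x ^ 2) ^ s) * ‖(𝓕 f : Lp ℂ 2 (volume : Measure ℝ)) x‖ₑ ^ 2 =
        ‖g x‖ₑ ^ 2 := by
  obtain ⟨g, hg⟩ := TemperedDistribution.memSobolev_iff_exists_smulLeftCLM_fourier.mp hf
  rw [Lp.fourier_toTemperedDistribution_eq] at hg
  set v : ℝ → ℂ := fun x => (((1 + ‖x‖ ^ 2) ^ (-s / 2) : ℝ) : ℂ) with hv
  have hv1 : v.HasTemperateGrowth := by fun_prop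
  have hvb : ∀ x, ‖v x‖ ≤ 1 := fun x => by
    rw [hv, Complex.norm_real, Real.norm_of_nonneg (by positivity)]
    exact Real.rpow_le_one_of_one_le_of_nonpos (by simp [sq_nonneg]) (by linarith)
  have hv2 : MemLp v ∞ (volume : Measure ℝ) :=
    memLp_top_of_bound hv1.1.continuous.aestronglyMeasurable 1 (ae_of_all _ hvb)
  have hsm := Lp.toTemperedDistribution_smul_eq (r := 2) hv1 hv2 g
  rw [← hg, TemperedDistribution.smulLeftCLM_smulLeftCLM_apply (by fun_prop) hv1] at hsm
  have h1 : (v * fun x : ℝ => (((1 + ‖x‖ ^ 2) ^ (s / 2) : ℝ) : ℂ)) = fun _ => (1 : ℂ) := by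
    ext x
    simp only [hv, Pi.mul_apply]
    norm_cast
    rw [← Real.rpow_add (by positivity)]
    ring_nf
    simp
  have h2 : (fun x : ℝ => (((1 + ‖x‖ ^ 2) ^ (s / 2) : ℝ) : ℂ)) * v = fun _ => (1 : ℂ) := by
    rw [mul_comm, h1]
  rw [h2, TemperedDistribution.smulLeftCLM_const, one_smul] at hsm
  have hker := Lp.ker_toTemperedDistributionCLM_eq_bot (F := ℂ) (p := 2) (μ := (volume : Measure ℝ))
  have heq := LinearMap.ker_eq_bot.1 hker hsm
  refine ⟨g, ?_⟩
  filter_upwards [Lp.coeFn_lpSMul (r := 2) (hv2.toLp _) g, hv2.coeFn_toLp] with x hx hx'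
  rw [← heq, hx, Pi.smul_apply', hx', smul_eq_mul, hv, enorm_mul, mul_pow, ← mul_assoc,
    enorm_eq_nnnorm, Complex.nnnorm_real, ← enorm_eq_nnnorm, Real.enorm_of_nonneg (by positivity),
    ← ENNReal.ofReal_pow (by positivity), ← ENNReal.ofReal_mul (by positivity), Real.norm_eq_abs,
    sq_abs, ← Real.rpow_natCast ((1 + x ^ 2) ^ (-s / 2)) 2, ← Real.rpow_mul (by positivity),
    ← Real.rpow_add (by positivity)]
  have : s + -s / 2 * ((2 : ℕ) : ℝ) = 0 := by push_cast; ring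
  rw [this, Real.rpow_zero, ENNReal.ofReal_one, one_mul]

theorem hsNorm_ne_top {s : ℝ} (hs : 0 ≤ s) (hf : MemHs s f) : hsNorm s f ≠ ∞ := by
  obtain ⟨g, hg⟩ := exists_memLp_weight_fourier hs hf
  have hc : (2 * Real.pi)⁻¹ ≠ 0 := by positivity
  have hpi := Real.pi_gt_three
  refine ENNReal.rpow_ne_top_of_nonneg (by norm_num) (ENNReal.mul_ne_top ENNReal.ofReal_ne_top ?_)
  set c := (2 * Real.pi)⁻¹ with hcdef
  set h : ℝ → ℝ≥0∞ := fun η => ENNReal.ofReal ((1 + (2 * Real.pi * η) ^ 2) ^ s) *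
    ‖(𝓕 f : Lp ℂ 2 (volume : Measure ℝ)) η‖ₑ ^ 2 with hh
  have hhm : Measurable h := by
    refine Measurable.mul ?_ ((Lp.stronglyMeasurable _).measurable.enorm.pow_const 2)
    refine ENNReal.measurable_ofReal.comp ?_
    exact (by fun_prop : Measurable fun η : ℝ => 1 + (2 * Real.pi * η) ^ 2).pow_const s
  have e : ∀ ξ : ℝ, ENNReal.ofReal ((1 + ξ ^ 2) ^ s) * ‖hat f ξ‖ₑ ^ 2 = h (c * ξ) := fun ξ => by
    have : 2 * Real.pi * (c * ξ) = ξ := by rw [hcdef]; field_simp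
    rw [hh]
    simp only [this, hat]
    rw [hcdef, div_eq_inv_mul]
  simp_rw [e]
  rw [← lintegral_map hhm (measurable_const_mul c), Real.map_volume_mul_left hc,
    lintegral_smul_measure]
  refine ENNReal.mul_ne_top ENNReal.ofReal_ne_top ?_
  have hle : ∫⁻ η, h η ≤ ENNReal.ofReal (((2 * Real.pi) ^ 2) ^ s) * ∫⁻ η, ‖g η‖ₑ ^ 2 := by
    rw [← lintegral_const_mul' _ _ ENNReal.ofReal_ne_top]
    refine lintegral_mono_ae ?_
    filter_upwards [hg] with η hη
    rw [← hη, ← mul_assoc, ← ENNReal.ofReal_mul (by positivity),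
      ← Real.mul_rpow (by positivity) (by positivity)]
    refine mul_le_mul_left (ENNReal.ofReal_le_ofReal (Real.rpow_le_rpow (by positivity) ?_ hs)) _
    nlinarith [sq_nonneg η]
  refine ne_top_of_le_ne_top (ENNReal.mul_ne_top ENNReal.ofReal_ne_top ?_) hle
  have := (Lp.memLp g).eLpNorm_lt_top
  rw [eLpNorm_lt_top_iff_lintegral_rpow_enorm_lt_top (by norm_num) (by norm_num)] at this
  simpa using this.ne

/-! ### Potentials of measures and summability almost everywhere -/

/-- Majorize `|x - y|^(-β)` by `1` plus multiples of indicators of dyadic balls around `x`; the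
growth of `ν` turns this into a geometric series of ratio `2^(β-α)`. -/
theorem exists_lintegral_potential_le {α β : ℝ} (hβ : 0 < β) (hβα : β < α) (A T : ℝ≥0) :
    ∃ V : ℝ≥0, ∀ ν : Measure ℝ,
      (∀ x r : ℝ, 0 < r → ν (Metric.ball x r) ≤ A * ENNReal.ofReal (r ^ α)) → ν univ ≤ T →
      ∀ x, ∫⁻ y, ‖x - y‖ₑ ^ (-β) ∂ν ≤ V := by
  set q : ℝ := 2 ^ (β - α) with hq
  have hq0 : 0 < q := by positivity
  have hq1 : q < 1 := Real.rpow_lt_one_of_one_lt_of_neg (by norm_num) (by linarith)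
  set W : ℝ≥0∞ := T + ∑' j : ℕ, A * (ENNReal.ofReal (2 ^ (β + α)) * ENNReal.ofReal q ^ j) with hW
  have hWt : W ≠ ∞ := by
    rw [hW]
    refine ENNReal.add_ne_top.2 ⟨ENNReal.coe_ne_top, ?_⟩
    rw [ENNReal.tsum_mul_left, ENNReal.tsum_mul_left, ENNReal.tsum_geometric]
    refine ENNReal.mul_ne_top ENNReal.coe_ne_top (ENNReal.mul_ne_top ENNReal.ofReal_ne_top ?_)
    rw [ENNReal.inv_ne_top]
    exact (tsub_pos_of_lt (by rwa [ENNReal.ofReal_lt_one])).ne'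
  refine ⟨W.toNNReal, fun ν hball hT x => ?_⟩
  rw [ENNReal.coe_toNNReal hWt]
  -- The factor 2 puts points at distance exactly `2^(-j)` inside the open ball.
  set R : ℕ → ℝ := fun j => 2 * (1 / 2) ^ j with hR
  have hR0 : ∀ j, 0 < R j := fun j => by positivity
  set c : ℕ → ℝ≥0∞ := fun j => ENNReal.ofReal (2 ^ (β * (j + 1))) with hc
  have hpt : ∀ y, ‖x - y‖ₑ ^ (-β) ≤
      1 + ∑' j, (Metric.ball x (R j)).indicator (fun _ => c j) y := by
    intro y
    -- At `y = x` both sides are `∞`, so atoms need no separate exclusion.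
    rcases eq_or_ne x y with rfl | hxy
    · have : ∑' j, (Metric.ball x (R j)).indicator (fun _ => c j) x = ∞ := by
        refine top_unique ?_
        rw [← ENNReal.tsum_const_eq_top_of_ne_zero (α := ℕ) (c := 1) one_ne_zero]
        refine ENNReal.tsum_le_tsum fun j => ?_
        rw [indicator_of_mem (Metric.mem_ball_self (hR0 j)), hc, ENNReal.one_le_ofReal]
        exact Real.one_le_rpow (by norm_num) (by positivity)
      rw [this, add_top]
      exact le_top
    have hr : 0 < |x - y| := abs_pos.2 (sub_ne_zero.2 hxy)
    rw [← ofReal_norm, Real.norm_eq_abs, ENNReal.ofReal_rpow_of_pos hr]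
    rcases le_or_gt |x - y| 1 with h1 | h1
    · obtain ⟨j, hj1, hj2⟩ := exists_nat_pow_near_of_lt_one hr h1 (by norm_num : (0 : ℝ) < 1 / 2)
        (by norm_num)
      refine le_trans ?_ le_add_self
      refine le_trans ?_ (ENNReal.le_tsum j)
      have hmem : y ∈ Metric.ball x (R j) := by
        rw [Metric.mem_ball, dist_comm, Real.dist_eq, hR]
        have : (0 : ℝ) < (1 / 2) ^ j := by positivity
        linarith
      rw [indicator_of_mem hmem, hc]
      refine ENNReal.ofReal_le_ofReal ?_
      calc |x - y| ^ (-β) ≤ ((1 / 2) ^ (j + 1)) ^ (-β) :=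
            Real.rpow_le_rpow_of_nonpos (by positivity) hj1.le (by linarith)
        _ = 2 ^ (β * (j + 1)) := by
            rw [one_div, inv_pow, Real.inv_rpow (by positivity), Real.rpow_neg (by positivity),
              inv_inv, ← Real.rpow_natCast, ← Real.rpow_mul (by norm_num)]
            push_cast
            ring_nf
    · refine le_trans ?_ le_self_add
      rw [ENNReal.ofReal_le_one]
      exact Real.rpow_le_one_of_one_le_of_nonpos h1.le (by linarith)
  calc ∫⁻ y, ‖x - y‖ₑ ^ (-β) ∂ν
      ≤ ∫⁻ y, (1 + ∑' j, (Metric.ball x (R j)).indicator (fun _ => c j) y) ∂ν :=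
        lintegral_mono hpt
    _ = ν univ + ∑' j, c j * ν (Metric.ball x (R j)) := by
        rw [lintegral_add_left measurable_const, lintegral_one, lintegral_tsum]
        · congr 2
          ext j
          rw [lintegral_indicator_const measurableSet_ball]
        · exact fun j => (measurable_const.indicator measurableSet_ball).aemeasurable
    _ ≤ T + ∑' j, c j * (A * ENNReal.ofReal (R j ^ α)) := by
        gcongr with j
        exact hball x (R j) (hR0 j)
    _ = W := by
        rw [hW]
        congr 2
        ext j
        rw [mul_left_comm]
        congr 1
        rw [hc, hR, ← ENNReal.ofReal_pow hq0.le, ← ENNReal.ofReal_mul (by positivity),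
          ← ENNReal.ofReal_mul (by positivity)]
        congr 1
        rw [Real.mul_rpow (by norm_num) (by positivity), one_div, inv_pow,
          Real.inv_rpow (by positivity), ← Real.rpow_natCast, ← Real.rpow_natCast, hq,
          ← Real.rpow_mul (by norm_num), ← Real.rpow_mul (by norm_num),
          ← Real.rpow_neg (by norm_num), ← Real.rpow_add (by norm_num),
          ← Real.rpow_add (by norm_num), ← Real.rpow_add (by norm_num)]
        ring_nf

/-- With `w²` the ratio in the block estimate, `M_n ≤ w^n + w^(-n) M_n²` pointwise. Integrating
gives `∫ M_n dν ≲ w^n`, which is summable. -/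
theorem ae_tsum_blockSup_ne_top {b s : ℝ} (hm : m ∈ Ioo (0 : ℝ) 1) (hκ : 1 ≤ κ) (hθ : 0 < θ)
    (hb0 : 0 < b) (hb : b ≤ 1 / 2) (hs : 0 ≤ s) (hbs : 1 - m * b - 2 * s < 0)
    (hf : hsNorm s f ≠ ∞) {ν : Measure ℝ} [IsFiniteMeasure ν] {V : ℝ≥0}
    (hV : ∀ x, ∫⁻ y, ‖x - y‖ₑ ^ (-b) ∂ν ≤ V) :
    ∀ᵐ x ∂ν, ∑' n, blockSup m θ κ f n x ≠ ∞ := by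
  obtain ⟨C, hC⟩ := exists_lintegral_blockSup_sq_le (θ := θ) hm hκ hθ hb0 hb
  set σ : ℝ := 2 ^ ((1 - m * b - 2 * s) / 2) with hσ
  have hσ0 : 0 < σ := by positivity
  have hσ1 : σ < 1 := Real.rpow_lt_one_of_one_lt_of_neg (by norm_num) (by linarith)
  have hσ2 : (2 : ℝ) ^ (1 - m * b - 2 * s) = σ * σ := by
    rw [hσ, ← Real.rpow_add (by norm_num)]; ring_nf
  set w : ℝ≥0∞ := ENNReal.ofReal σ with hw
  have hw0 : w ≠ 0 := by rw [hw, Ne, ENNReal.ofReal_eq_zero, not_le]; exact hσ0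
  have hwt : w ≠ ∞ := ENNReal.ofReal_ne_top
  have hmeas := fun n => measurable_blockSup (θ := θ) hm.1 hκ f n
  set K : ℝ≥0∞ := C * V * hsNorm s f ^ 2 with hK
  have hKt : K ≠ ∞ := ENNReal.mul_ne_top (ENNReal.mul_ne_top ENNReal.coe_ne_top ENNReal.coe_ne_top)
    (ENNReal.pow_ne_top hf)
  have hn : ∀ n, ∫⁻ x, blockSup m θ κ f n x ∂ν ≤ (ν univ + K) * w ^ n := by
    intro n
    have hwn0 : w ^ n ≠ 0 := pow_ne_zero n hw0
    have hwnt : w ^ n ≠ ∞ := ENNReal.pow_ne_top hwt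
    calc ∫⁻ x, blockSup m θ κ f n x ∂ν
        ≤ ∫⁻ x, (w ^ n + (w ^ n)⁻¹ * blockSup m θ κ f n x ^ 2) ∂ν := by
          refine lintegral_mono fun x => ?_
          rcases le_total (blockSup m θ κ f n x) (w ^ n) with h | h
          · exact h.trans le_self_add
          · refine le_trans ?_ le_add_self
            calc blockSup m θ κ f n x = (w ^ n)⁻¹ * (w ^ n * blockSup m θ κ f n x) := by
                  rw [← mul_assoc, ENNReal.inv_mul_cancel hwn0 hwnt, one_mul]
              _ ≤ _ := by rw [sq]; gcongr
      _ = w ^ n * ν univ + (w ^ n)⁻¹ * ∫⁻ x, blockSup m θ κ f n x ^ 2 ∂ν := by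
          rw [lintegral_add_left measurable_const, lintegral_const,
            lintegral_const_mul _ ((hmeas n).pow_const 2)]
      _ ≤ w ^ n * ν univ + (w ^ n)⁻¹ * (K * (w ^ n * w ^ n)) := by
          gcongr
          refine (hC s f n ν V hs inferInstance hV).trans (le_of_eq ?_)
          rw [hσ2, mul_pow, ENNReal.ofReal_mul (by positivity), ENNReal.ofReal_pow hσ0.le, hK, hw]
          ring
      _ = (ν univ + K) * w ^ n := by
          have : (w ^ n)⁻¹ * (K * (w ^ n * w ^ n)) = K * w ^ n * ((w ^ n)⁻¹ * w ^ n) := by ring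
          rw [this, ENNReal.inv_mul_cancel hwn0 hwnt]
          ring
  have htot : ∫⁻ x, ∑' n, blockSup m θ κ f n x ∂ν ≠ ∞ := by
    rw [lintegral_tsum fun n => (hmeas n).aemeasurable]
    refine ne_top_of_le_ne_top ?_ (ENNReal.tsum_le_tsum hn)
    rw [ENNReal.tsum_mul_left, ENNReal.tsum_geometric]
    refine ENNReal.mul_ne_top (ENNReal.add_ne_top.2 ⟨measure_ne_top _ _, hKt⟩) ?_
    rw [ENNReal.inv_ne_top]
    exact (tsub_pos_of_lt (by rwa [hw, ENNReal.ofReal_lt_one])).ne'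
  filter_upwards [ae_lt_top (Measurable.tsum hmeas) htot] with x hx
  exact hx.ne

/-! ### Identification of the limit with `f` -/

theorem continuous_fourierInv {g : ℝ → ℂ} (hg : Integrable g) : Continuous (𝓕⁻ g) := by
  refine VectorFourier.fourierIntegral_continuous Real.continuous_fourierChar (L := -innerₗ ℝ) ?_ hg
  simp only [LinearMap.neg_apply]
  exact continuous_inner.neg

/-- Both sides are tested against compactly supported smooth functions, and the inverse transform is
moved to the test function on each side. -/
theorem fourierInv_toLp_ae_eq {g : ℝ → ℂ} (hg : Integrable g) (hg2 : MemLp g 2) :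
    ∀ᵐ x, (𝓕⁻ (hg2.toLp g) : Lp ℂ 2 (volume : Measure ℝ)) x = 𝓕⁻ g x := by
  refine ae_eq_of_integral_contDiff_smul_eq ((Lp.memLp _).locallyIntegrable (by norm_num))
    (continuous_fourierInv hg).locallyIntegrable fun φ hφ hφc => ?_
  have hc1 : HasCompactSupport (Complex.ofRealCLM ∘ φ) := hφc.comp_left rfl
  have hc2 : ContDiff ℝ ((⊤ : ℕ∞) : WithTop ℕ∞) (Complex.ofRealCLM ∘ φ) := by fun_prop
  set u : 𝓢(ℝ, ℂ) := hc1.toSchwartzMap hc2 with hu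
  have hux : ∀ x, u x = (φ x : ℂ) := fun x => rfl
  have e1 := DFunLike.congr_fun (Lp.fourierInv_toTemperedDistribution_eq (hg2.toLp g)) u
  rw [TemperedDistribution.fourierInv_apply, Lp.toTemperedDistribution_apply,
    Lp.toTemperedDistribution_apply] at e1
  have e2 : ∫ x, (𝓕⁻ u) x • (hg2.toLp g) x = ∫ x, (𝓕⁻ (u : ℝ → ℂ)) x • g x := by
    refine integral_congr_ae ?_
    filter_upwards [hg2.coeFn_toLp] with x hx
    rw [hx, SchwartzMap.fourierInv_coe]
  have e3 : ∫ x, (𝓕⁻ (u : ℝ → ℂ)) x • g x = ∫ x, u x • 𝓕⁻ g x := by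
    have hflip : (-innerₗ ℝ : ℝ →ₗ[ℝ] ℝ →ₗ[ℝ] ℝ).flip = -innerₗ ℝ := by
      ext
      simp
    have := VectorFourier.integral_fourierIntegral_smul_eq_flip (e := Real.fourierChar)
      (μ := (volume : Measure ℝ)) (ν := (volume : Measure ℝ)) (L := -innerₗ ℝ)
      Real.continuous_fourierChar (by simp only [LinearMap.neg_apply]; exact continuous_inner.neg)
      u.integrable hg
    rw [hflip] at this
    exact this
  rw [e2, e3] at e1
  simpa only [hux, Complex.real_smul, smul_eq_mul] using e1.symm

/-- The Fourier transform of `f`, in Mathlib's normalization, truncated to `|η| ≤ N / (2π)`. -/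
def truncFourier (f : Lp ℂ 2 (volume : Measure ℝ)) (N : ℝ) : ℝ → ℂ :=
  {η : ℝ | |2 * Real.pi * η| ≤ N}.indicator (𝓕 f : Lp ℂ 2 (volume : Measure ℝ))

theorem measurableSet_abs_mul_le (N : ℝ) : MeasurableSet {η : ℝ | |2 * Real.pi * η| ≤ N} :=
  measurableSet_le (by fun_prop) measurable_const

theorem memLp_truncFourier (f : Lp ℂ 2 (volume : Measure ℝ)) (N : ℝ) :
    MemLp (truncFourier f N) 2 :=
  (Lp.memLp _).indicator (measurableSet_abs_mul_le N)

theorem integrable_truncFourier (f : Lp ℂ 2 (volume : Measure ℝ)) (N : ℝ) :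
    Integrable (truncFourier f N) := by
  have hsub : {η : ℝ | |2 * Real.pi * η| ≤ N} ⊆ Icc (-N) N := by
    intro η hη
    refine abs_le.1 (le_trans ?_ hη)
    rw [abs_mul, abs_of_pos (by positivity : 0 < 2 * Real.pi)]
    exact le_mul_of_one_le_left (abs_nonneg _) (by linarith [Real.pi_gt_three])
  have : Fact (volume {η : ℝ | |2 * Real.pi * η| ≤ N} < ∞) :=
    ⟨(measure_mono hsub).trans_lt measure_Icc_lt_top⟩
  rw [truncFourier, integrable_indicator_iff (measurableSet_abs_mul_le N)]
  exact ((Lp.memLp _).restrict _).integrable (by norm_num)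

theorem partialSol_zero_eq (m : ℝ) (f : Lp ℂ 2 (volume : Measure ℝ)) (N x : ℝ) :
    partialSol m f N x 0 = 𝓕⁻ (truncFourier f N) x := by
  have hpi : (0 : ℝ) < 2 * Real.pi := by positivity
  rw [partialSol_eq, Real.fourierInv_eq', ← integral_indicator measurableSet_Icc]
  have h := Measure.integral_comp_div (fun η : ℝ =>
    Complex.exp (((2 * Real.pi * inner ℝ η x : ℝ) : ℂ) * Complex.I) • truncFourier f N η)
    (2 * Real.pi)
  rw [abs_of_pos hpi] at h
  have h2 : ∀ A B : ℂ, A = (2 * Real.pi) • B → (((2 * Real.pi)⁻¹ : ℝ) : ℂ) * A = B := by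
    rintro A B rfl
    rw [Complex.real_smul, ← mul_assoc, ← Complex.ofReal_mul, inv_mul_cancel₀ hpi.ne',
      Complex.ofReal_one, one_mul]
  refine h2 _ _ (h ▸ ?_)
  congr 1
  ext ξ
  have e : 2 * Real.pi * (ξ / (2 * Real.pi)) = ξ := by field_simp
  by_cases hξ : |ξ| ≤ N
  · rw [indicator_of_mem (show ξ ∈ Icc (-N) N from abs_le.1 hξ), truncFourier, indicator_of_mem
      (show ξ / (2 * Real.pi) ∈ {η : ℝ | |2 * Real.pi * η| ≤ N} by
        rw [mem_ofPred_eq, e]; exact hξ), smul_eq_mul, hat, wave]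
    congr 2
    rw [mul_comm]
    congr 2
    simp only [RCLike.inner_apply, conj_trivial]
    rw [zero_mul, add_zero]
    field_simp
  · rw [indicator_of_notMem (show ξ ∉ Icc (-N) N from fun h => hξ (abs_le.2 h)), truncFourier,
      indicator_of_notMem (show ξ / (2 * Real.pi) ∉ {η : ℝ | |2 * Real.pi * η| ≤ N} by
        rw [mem_ofPred_eq, e]; exact hξ), smul_zero]

theorem tendsto_truncFourier (f : Lp ℂ 2 (volume : Measure ℝ)) {N : ℕ → ℝ}
    (hN : Tendsto N atTop atTop) :
    Tendsto (fun n => (memLp_truncFourier f (N n)).toLp _) atTop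
      (𝓝 (𝓕 f : Lp ℂ 2 (volume : Measure ℝ))) := by
  set F : Lp ℂ 2 (volume : Measure ℝ) := 𝓕 f with hF
  rw [← Lp.toLp_coeFn F (Lp.memLp F), Lp.tendsto_Lp_iff_tendsto_eLpNorm'']
  have e : ∀ n, eLpNorm (truncFourier f (N n) - (F : ℝ → ℂ)) 2 volume =
      (∫⁻ η, ‖(truncFourier f (N n) - (F : ℝ → ℂ)) η‖ₑ ^ (2 : ℝ)) ^ (1 / 2 : ℝ) := fun n => by
    rw [eLpNorm_eq_lintegral_rpow_enorm_toReal (by norm_num) (by norm_num)]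
    simp only [ENNReal.toReal_ofNat]
  simp_rw [e]
  have hz : (0 : ℝ≥0∞) = 0 ^ (1 / 2 : ℝ) := by rw [ENNReal.zero_rpow_of_pos (by norm_num)]
  rw [hz]
  refine ((ENNReal.continuous_rpow_const).tendsto _).comp ?_
  rw [← lintegral_zero (μ := (volume : Measure ℝ))]
  have hFm : Measurable F := (Lp.stronglyMeasurable F).measurable
  refine tendsto_lintegral_of_dominated_convergence (fun η => ‖F η‖ₑ ^ (2 : ℝ)) (fun n => ?_)
    (fun n => ae_of_all _ fun η => ?_) ?_ (ae_of_all _ fun η => ?_)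
  · exact ((hFm.indicator (measurableSet_abs_mul_le _)).sub hFm).enorm.pow_const _
  · refine ENNReal.rpow_le_rpow ?_ (by norm_num)
    simp only [Pi.sub_apply, truncFourier, ← hF]
    by_cases h : η ∈ {η : ℝ | |2 * Real.pi * η| ≤ N n}
    · rw [indicator_of_mem h, sub_self, enorm_zero]; exact zero_le
    · rw [indicator_of_notMem h, zero_sub, enorm_neg]
  · have := (Lp.memLp F).eLpNorm_lt_top
    rw [eLpNorm_lt_top_iff_lintegral_rpow_enorm_lt_top (by norm_num) (by norm_num)] at this
    simpa using this.ne
  · refine tendsto_const_nhds.congr' ?_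
    filter_upwards [hN.eventually_ge_atTop |2 * Real.pi * η|] with n hn
    simp only [Pi.sub_apply, truncFourier, ← hF]
    rw [indicator_of_mem (show η ∈ {η : ℝ | |2 * Real.pi * η| ≤ N n} from hn), sub_self,
      enorm_zero, ENNReal.zero_rpow_of_pos (by norm_num)]

/-- The truncations converge to `f` in `L²` by Plancherel, hence almost everywhere along a
subsequence. This suffices because existence of the full limit comes from the block estimates. -/
theorem exists_subseq_partialSol_zero_tendsto (m : ℝ) (f : Lp ℂ 2 (volume : Measure ℝ)) :
    ∃ ns : ℕ → ℕ, StrictMono ns ∧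
      ∀ᵐ x, Tendsto (fun i => partialSol m f (ns i) x 0) atTop (𝓝 (f x)) := by
  have h1 := tendsto_truncFourier f tendsto_natCast_atTop_atTop
  have h2 : Tendsto (fun n : ℕ => (𝓕⁻ ((memLp_truncFourier f n).toLp _) :
      Lp ℂ 2 (volume : Measure ℝ))) atTop (𝓝 f) := by
    have := ((Lp.fourierTransformₗᵢ ℝ ℂ).symm.continuous.tendsto _).comp h1
    rwa [show (Lp.fourierTransformₗᵢ ℝ ℂ).symm (𝓕 f) = f from
      (Lp.fourierTransformₗᵢ ℝ ℂ).symm_apply_apply f] at this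
  obtain ⟨ns, hns, hae⟩ := (tendstoInMeasure_of_tendsto_Lp h2).exists_seq_tendsto_ae
  refine ⟨ns, hns, ?_⟩
  have hall : ∀ᵐ x : ℝ, ∀ n : ℕ, (𝓕⁻ ((memLp_truncFourier f n).toLp _) :
      Lp ℂ 2 (volume : Measure ℝ)) x = 𝓕⁻ (truncFourier f n) x :=
    ae_all_iff.2 fun n => fourierInv_toLp_ae_eq (integrable_truncFourier f n) _
  filter_upwards [hae, hall] with x hx hx'
  refine hx.congr fun i => ?_
  rw [hx', partialSol_zero_eq]

theorem ae_sol_zero_eq (h : ∀ᵐ x : ℝ, SolExists m f x 0) : ∀ᵐ x : ℝ, sol m f x 0 = f x := by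
  obtain ⟨ns, hns, hae⟩ := exists_subseq_partialSol_zero_tendsto m f
  filter_upwards [h, hae] with x hx hx'
  obtain ⟨c, hc⟩ := hx
  have h3 := hc.comp (tendsto_natCast_atTop_atTop.comp hns.tendsto_atTop)
  rw [sol, hc.limUnder_eq]
  exact tendsto_nhds_unique h3 hx'

theorem ae_convergesAlong {s : ℝ} (hm : m ∈ Ioo (0 : ℝ) 1) (hκ : 1 ≤ κ) (hθ : 0 < θ)
    (hs : 1 / 2 - m / 4 < s) (hf : MemHs s f) : ∀ᵐ x : ℝ, ConvergesAlong m θ κ f x (f x) := by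
  have hs0 : 0 ≤ s := by linarith [hm.2]
  have hH := hsNorm_ne_top hs0 hf
  have hloc : ∀ k : ℕ, ∀ᵐ x ∂(volume.restrict (Metric.ball (0 : ℝ) k)),
      ∑' n, blockSup m θ κ f n x ≠ ∞ := by
    intro k
    have hfin : IsFiniteMeasure (volume.restrict (Metric.ball (0 : ℝ) k)) :=
      ⟨by rw [Measure.restrict_apply_univ]; exact measure_ball_lt_top⟩
    obtain ⟨V, hV⟩ := exists_lintegral_potential_le (α := 1) (β := 1 / 2) (by norm_num)
      (by norm_num) 2 (2 * k)
    -- The largest admissible `b` is allowed because Lebesgue measure has dimension `1 > 1/2`; then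
    -- `1 - mb - 2s < 0` reads `s > 1/2 - m/4`.
    refine ae_tsum_blockSup_ne_top (b := 1 / 2) (V := V) hm hκ hθ (by norm_num) le_rfl hs0
      (by linarith) hH (hV _ (fun x r hr => ?_) ?_)
    · refine (Measure.restrict_apply_le _ _).trans ?_
      rw [Real.volume_ball, Real.rpow_one, ENNReal.ofReal_mul (by norm_num)]
      simp
    · rw [Measure.restrict_apply_univ, Real.volume_ball, ENNReal.ofReal_mul (by norm_num)]
      simp
  have hall : ∀ᵐ x : ℝ, ∑' n, blockSup m θ κ f n x ≠ ∞ := by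
    have := (ae_restrict_iUnion_iff (μ := (volume : Measure ℝ))
      (fun k : ℕ => Metric.ball (0 : ℝ) k) _).2 hloc
    rwa [Metric.iUnion_ball_nat, Measure.restrict_univ] at this
  have hconv : ∀ᵐ x : ℝ, SolExists m f x 0 ∧ ConvergesAlong m θ κ f x (sol m f x 0) :=
    hall.mono fun x hx => solExists_zero_and_convergesAlong hm.1 hκ hx
  filter_upwards [hconv, ae_sol_zero_eq (hconv.mono fun x hx => hx.1)] with x hx hx'
  rw [← hx']
  exact hx.2

/-! ### The `L^q` maximal estimate -/

/-- A purely qualitative bound: it supplies the finiteness required to cancel integrals and to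
discard finitely many blocks. -/
theorem exists_blockSup_le (hm : 0 < m) (f : Lp ℂ 2 (volume : Measure ℝ)) (n : ℕ) :
    ∃ R : ℝ≥0∞, R ≠ ∞ ∧ ∀ x, blockSup m θ κ f n x ≤ R := by
  refine ⟨∫⁻ ξ in annulus (2 ^ n) (2 ^ (n + 1)), ‖hat f ξ‖ₑ,
    (integrableOn_hat f (volume_annulus_lt_top _ _)).2.ne, fun x => iSup_le fun p => ?_⟩
  refine (enorm_increment_le hm n x p).trans ((enorm_integral_le_lintegral_enorm _).trans ?_)
  have e : ∀ ξ, ‖wave m (curve θ κ x p.1) p.1 ξ * hat f ξ‖ₑ = ‖hat f ξ‖ₑ := fun ξ => by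
    rw [← ofReal_norm, ← ofReal_norm, norm_mul, norm_wave, one_mul]
  simp_rw [e]
  exact lintegral_mono_set fun ξ h => ⟨h.1, h.2.trans p.2.2.2⟩

/-- Apply the `L²` estimate to `dν = M^(q-2) dμ`. Its left side is `I = ∫ M^q dμ`, and Hölder bounds
the potential of `ν` by `I^(1-2/q) V^(2/q)`. Cancelling `I^(1-2/q)` leaves a bound for `I^(2/q)`. -/
theorem exists_lintegral_blockSup_rpow_le {b q : ℝ} (hm : m ∈ Ioo (0 : ℝ) 1) (hκ : 1 ≤ κ)
    (hθ : 0 < θ) (hb0 : 0 < b) (hb : b ≤ 1 / 2) (hq : 2 ≤ q) :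
    ∃ C : ℝ≥0, ∀ (s : ℝ) (f : Lp ℂ 2 (volume : Measure ℝ)) (n : ℕ) (μ : Measure ℝ)
      (V : ℝ≥0∞), 0 ≤ s → IsFiniteMeasure μ → (∀ x, ∫⁻ y, ‖x - y‖ₑ ^ (-(b * q / 2)) ∂μ ≤ V) →
      ∫⁻ x, blockSup m θ κ f n x ^ q ∂μ ≤
        (C * V ^ (2 / q) * ENNReal.ofReal ((2 ^ (1 - m * b - 2 * s)) ^ n) *
          hsNorm s f ^ 2) ^ (q / 2) := by
  obtain ⟨C, hC⟩ := exists_lintegral_blockSup_sq_le (θ := θ) hm hκ hθ hb0 hb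
  refine ⟨C, fun s f n μ V hs hμ hV => ?_⟩
  have hq0 : 0 < q := by linarith
  have hq2 : 0 ≤ 1 - 2 / q := by rw [sub_nonneg, div_le_one hq0]; exact hq
  have hM := measurable_blockSup (θ := θ) hm.1 hκ f n
  obtain ⟨R, hR, hMR⟩ := exists_blockSup_le (θ := θ) (κ := κ) hm.1 f n
  set M := blockSup m θ κ f n with hMdef
  set I := ∫⁻ x, M x ^ q ∂μ with hI
  have hIt : I ≠ ∞ := by
    refine ne_top_of_le_ne_top ?_ (lintegral_mono fun x =>
      ENNReal.rpow_le_rpow (hMR x) hq0.le)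
    rw [lintegral_const]
    exact ENNReal.mul_ne_top (ENNReal.rpow_ne_top_of_nonneg hq0.le hR) (measure_ne_top _ _)
  have hMq : Measurable fun x => M x ^ (q - 2) := hM.pow_const _
  set ν := μ.withDensity fun x => M x ^ (q - 2) with hν
  have hνf : IsFiniteMeasure ν := by
    refine isFiniteMeasure_withDensity ?_
    refine ne_top_of_le_ne_top ?_ (lintegral_mono fun x =>
      ENNReal.rpow_le_rpow (hMR x) (by linarith : 0 ≤ q - 2))
    rw [lintegral_const]
    exact ENNReal.mul_ne_top (ENNReal.rpow_ne_top_of_nonneg (by linarith) hR) (measure_ne_top _ _)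
  have hνI : ∫⁻ x, M x ^ 2 ∂ν = I := by
    rw [hν, lintegral_withDensity_eq_lintegral_mul _ hMq (hM.pow_const 2)]
    refine lintegral_congr fun x => ?_
    rw [Pi.mul_apply, ← ENNReal.rpow_two, ← ENNReal.rpow_add_of_nonneg _ _ (by linarith)
      (by norm_num)]
    ring_nf
  have hpot : ∀ x, ∫⁻ y, ‖x - y‖ₑ ^ (-b) ∂ν ≤ I ^ (1 - 2 / q) * V ^ (2 / q) := by
    intro x
    have hm1 : Measurable fun y : ℝ => ‖x - y‖ₑ ^ (-b) := by fun_prop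
    have hm2 : Measurable fun y : ℝ => ‖x - y‖ₑ ^ (-(b * q / 2)) := by fun_prop
    rw [hν, lintegral_withDensity_eq_lintegral_mul _ hMq hm1]
    calc ∫⁻ y, ((fun x => M x ^ (q - 2)) * fun y => ‖x - y‖ₑ ^ (-b)) y ∂μ
        = ∫⁻ y, (M y ^ q) ^ (1 - 2 / q) * (‖x - y‖ₑ ^ (-(b * q / 2))) ^ (2 / q) ∂μ := by
          refine lintegral_congr fun y => ?_
          rw [Pi.mul_apply, ← ENNReal.rpow_mul, ← ENNReal.rpow_mul]
          congr 2
          · field_simp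
          · field_simp
      _ ≤ I ^ (1 - 2 / q) * (∫⁻ y, ‖x - y‖ₑ ^ (-(b * q / 2)) ∂μ) ^ (2 / q) :=
          ENNReal.lintegral_mul_norm_pow_le (hM.pow_const q).aemeasurable hm2.aemeasurable hq2
            (by positivity) (by ring)
      _ ≤ _ := by
          gcongr
          exact hV x
  have key := hC s f n ν _ hs hνf hpot
  rw [hνI] at key
  set K := C * V ^ (2 / q) * ENNReal.ofReal ((2 ^ (1 - m * b - 2 * s)) ^ n) * hsNorm s f ^ 2 with hK
  rcases eq_or_ne I 0 with h0 | h0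
  · rw [h0]; exact zero_le
  have hp0 : I ^ (1 - 2 / q) ≠ 0 := (ENNReal.rpow_pos (pos_iff_ne_zero.2 h0) hIt).ne'
  have hpt : I ^ (1 - 2 / q) ≠ ∞ := ENNReal.rpow_ne_top_of_nonneg hq2 hIt
  have h1 : I ^ (2 / q) * I ^ (1 - 2 / q) ≤ K * I ^ (1 - 2 / q) := by
    rw [← ENNReal.rpow_add_of_nonneg _ _ (by positivity) hq2, add_sub_cancel, ENNReal.rpow_one]
    refine key.trans (le_of_eq ?_)
    rw [hK]
    ring
  have h2 := (ENNReal.mul_le_mul_iff_left hp0 hpt).1 h1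
  calc I = (I ^ (2 / q)) ^ (q / 2) := by
        rw [← ENNReal.rpow_mul, div_mul_div_cancel₀ hq0.ne', div_self (by norm_num),
          ENNReal.rpow_one]
    _ ≤ _ := ENNReal.rpow_le_rpow h2 (by positivity)

/-- Each `w^(-n) a_n` is at most the `ℓ^q` norm of these weighted terms. This exchanges the power of
a sum for a sum of powers at a geometric cost. -/
theorem tsum_rpow_le_of_geometric {w : ℝ≥0∞} (hw0 : w ≠ 0) (hwt : w ≠ ∞) {q : ℝ} (hq : 0 < q)
    (a : ℕ → ℝ≥0∞) :
    (∑' n, a n) ^ q ≤ ((1 - w)⁻¹) ^ q * ∑' n, ((w ^ n)⁻¹ * a n) ^ q := by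
  set Z := ∑' n, ((w ^ n)⁻¹ * a n) ^ q with hZ
  have h1 : ∀ n, a n ≤ w ^ n * Z ^ (1 / q) := by
    intro n
    have hwn0 : w ^ n ≠ 0 := pow_ne_zero n hw0
    have hwnt : w ^ n ≠ ∞ := ENNReal.pow_ne_top hwt
    have h2 : (w ^ n)⁻¹ * a n ≤ Z ^ (1 / q) := by
      rw [one_div, ENNReal.le_rpow_inv_iff hq]
      exact ENNReal.le_tsum (f := fun n => ((w ^ n)⁻¹ * a n) ^ q) n
    calc a n = w ^ n * ((w ^ n)⁻¹ * a n) := by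
          rw [← mul_assoc, ENNReal.mul_inv_cancel hwn0 hwnt, one_mul]
      _ ≤ _ := by gcongr
  calc (∑' n, a n) ^ q ≤ (∑' n, w ^ n * Z ^ (1 / q)) ^ q :=
        ENNReal.rpow_le_rpow (ENNReal.tsum_le_tsum h1) hq.le
    _ = _ := by
        rw [ENNReal.tsum_mul_right, ENNReal.tsum_geometric, ENNReal.mul_rpow_of_nonneg _ _ hq.le,
          ← ENNReal.rpow_mul, one_div_mul_cancel hq.ne', ENNReal.rpow_one]

theorem exists_lintegral_tsum_blockSup_rpow_le {b q s : ℝ} (hm : m ∈ Ioo (0 : ℝ) 1) (hκ : 1 ≤ κ)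
    (hθ : 0 < θ) (hb0 : 0 < b) (hb : b ≤ 1 / 2) (hq : 2 ≤ q) (hs : 0 ≤ s)
    (hbs : 1 - m * b - 2 * s < 0) (V : ℝ≥0) :
    ∃ C : ℝ≥0, ∀ (f : Lp ℂ 2 (volume : Measure ℝ)) (μ : Measure ℝ), IsFiniteMeasure μ →
      (∀ x, ∫⁻ y, ‖x - y‖ₑ ^ (-(b * q / 2)) ∂μ ≤ V) →
      ∫⁻ x, (∑' n, blockSup m θ κ f n x) ^ q ∂μ ≤ C * hsNorm s f ^ q := by
  obtain ⟨C, hC⟩ := exists_lintegral_blockSup_rpow_le (θ := θ) hm hκ hθ hb0 hb hq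
  have hq0 : 0 < q := by linarith
  -- The `L^q` norm of the `n`th block decays like `σ^(2n)`: one factor `σ^n` pays for the weight
  -- `w^(-n)`, the other makes the series converge.
  set σ : ℝ := 2 ^ ((1 - m * b - 2 * s) / 4) with hσ
  have hσ0 : 0 < σ := by positivity
  have hσ1 : σ < 1 := Real.rpow_lt_one_of_one_lt_of_neg (by norm_num) (by linarith)
  have hσ4 : (2 : ℝ) ^ (1 - m * b - 2 * s) = σ ^ 4 := by
    rw [hσ, ← Real.rpow_natCast, ← Real.rpow_mul (by norm_num)]
    congr 1
    push_cast
    ring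
  set w : ℝ≥0∞ := ENNReal.ofReal σ with hw
  have hw0 : w ≠ 0 := by rw [hw, Ne, ENNReal.ofReal_eq_zero, not_le]; exact hσ0
  have hwt : w ≠ ∞ := ENNReal.ofReal_ne_top
  have hw1 : w < 1 := by rwa [hw, ENNReal.ofReal_lt_one]
  have hwq : w ^ q < 1 := ENNReal.rpow_lt_one hw1 hq0
  have hG : (1 - w)⁻¹ ≠ ∞ := ENNReal.inv_ne_top.2 (tsub_pos_of_lt hw1).ne'
  set D : ℝ≥0∞ := ((1 - w)⁻¹) ^ q * ((C * (V : ℝ≥0∞) ^ (2 / q)) ^ (q / 2) * (1 - w ^ q)⁻¹) with hD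
  have hDt : D ≠ ∞ := by
    refine ENNReal.mul_ne_top (ENNReal.rpow_ne_top_of_nonneg hq0.le hG) (ENNReal.mul_ne_top ?_ ?_)
    · exact ENNReal.rpow_ne_top_of_nonneg (by positivity) (ENNReal.mul_ne_top ENNReal.coe_ne_top
        (ENNReal.rpow_ne_top_of_nonneg (by positivity) ENNReal.coe_ne_top))
    · exact ENNReal.inv_ne_top.2 (tsub_pos_of_lt hwq).ne'
  refine ⟨D.toNNReal, fun f μ hμ hV => ?_⟩
  rw [ENNReal.coe_toNNReal hDt]
  have hmeas := fun n => measurable_blockSup (θ := θ) hm.1 hκ f n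
  calc ∫⁻ x, (∑' n, blockSup m θ κ f n x) ^ q ∂μ
      ≤ ∫⁻ x, ((1 - w)⁻¹) ^ q * ∑' n, ((w ^ n)⁻¹ * blockSup m θ κ f n x) ^ q ∂μ :=
        lintegral_mono fun x => tsum_rpow_le_of_geometric hw0 hwt hq0 _
    _ = ((1 - w)⁻¹) ^ q * ∑' n, ((w ^ n)⁻¹) ^ q * ∫⁻ x, blockSup m θ κ f n x ^ q ∂μ := by
        rw [lintegral_const_mul' _ _ (ENNReal.rpow_ne_top_of_nonneg hq0.le hG),
          lintegral_tsum fun n => (((hmeas n).const_mul _).pow_const q).aemeasurable]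
        congr 2
        ext n
        rw [← lintegral_const_mul _ ((hmeas n).pow_const q)]
        exact lintegral_congr fun x => ENNReal.mul_rpow_of_nonneg _ _ hq0.le
    _ ≤ ((1 - w)⁻¹) ^ q * ∑' n, (C * (V : ℝ≥0∞) ^ (2 / q)) ^ (q / 2) * hsNorm s f ^ q *
          (w ^ q) ^ n := by
        refine mul_le_mul' le_rfl (ENNReal.tsum_le_tsum fun n => ?_)
        have hwn0 : w ^ n ≠ 0 := pow_ne_zero n hw0
        have hwnt : w ^ n ≠ ∞ := ENNReal.pow_ne_top hwt
        calc ((w ^ n)⁻¹) ^ q * ∫⁻ x, blockSup m θ κ f n x ^ q ∂μ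
            ≤ ((w ^ n)⁻¹) ^ q * ((C * (V : ℝ≥0∞) ^ (2 / q)) ^ (q / 2) * hsNorm s f ^ q *
                ((w ^ n) ^ q * (w ^ n) ^ q)) := by
              gcongr
              refine (hC s f n μ V hs hμ hV).trans (le_of_eq ?_)
              have e1 : ENNReal.ofReal ((2 ^ (1 - m * b - 2 * s)) ^ n) =
                  (w ^ n) ^ 2 * (w ^ n) ^ 2 := by
                rw [hσ4, ENNReal.ofReal_pow (by positivity), ENNReal.ofReal_pow hσ0.le, hw]
                ring
              have e2 : ∀ z : ℝ≥0∞, (z ^ 2) ^ (q / 2) = z ^ q := fun z => by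
                rw [← ENNReal.rpow_two, ← ENNReal.rpow_mul]
                congr 1
                ring
              rw [e1, ENNReal.mul_rpow_of_nonneg _ _ (by positivity : 0 ≤ q / 2),
                ENNReal.mul_rpow_of_nonneg _ _ (by positivity : 0 ≤ q / 2),
                ENNReal.mul_rpow_of_nonneg _ _ (by positivity : 0 ≤ q / 2), e2,
                ENNReal.mul_rpow_of_nonneg _ _ (by positivity : 0 ≤ q / 2), e2]
              ring
          _ = (C * (V : ℝ≥0∞) ^ (2 / q)) ^ (q / 2) * hsNorm s f ^ q * (w ^ n) ^ q *
                (((w ^ n)⁻¹) ^ q * (w ^ n) ^ q) := by ring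
          _ = _ := by
              rw [← ENNReal.mul_rpow_of_nonneg _ _ hq0.le, ENNReal.inv_mul_cancel hwn0 hwnt,
                ENNReal.one_rpow, mul_one, ← ENNReal.rpow_natCast, ← ENNReal.rpow_natCast,
                ← ENNReal.rpow_mul, ← ENNReal.rpow_mul, mul_comm (n : ℝ)]
    _ = D * hsNorm s f ^ q := by
        rw [ENNReal.tsum_mul_left, ENNReal.tsum_geometric, hD]
        ring

theorem enorm_partialSol_one_le {s : ℝ} (hs : 0 ≤ s) (y t : ℝ) :
    ‖partialSol m f 1 y t‖ₑ ≤
      (ENNReal.ofReal (2 * Real.pi) * 2) ^ (1 / 2 : ℝ) * hsNorm s f := by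
  have h2 : ‖(((2 * Real.pi)⁻¹ : ℝ) : ℂ)‖ ≤ 1 := by
    rw [Complex.norm_real, Real.norm_of_nonneg (by positivity)]
    exact inv_le_one_of_one_le₀ (by linarith [Real.pi_gt_three])
  have h3 : ‖partialSol m f 1 y t‖ₑ ≤ ∫⁻ ξ in Icc (-1 : ℝ) 1, ‖hat f ξ‖ₑ := by
    rw [partialSol_eq, enorm_mul]
    have e : ∀ ξ, ‖wave m y t ξ * hat f ξ‖ₑ = ‖hat f ξ‖ₑ := fun ξ => by
      rw [← ofReal_norm, ← ofReal_norm, norm_mul, norm_wave, one_mul]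
    refine (mul_le_of_le_one_left zero_le ?_).trans
      ((enorm_integral_le_lintegral_enorm _).trans (le_of_eq ?_))
    · rw [← ofReal_norm]; exact ENNReal.ofReal_le_one.2 h2
    · simp_rw [e]
  have h4 := ENNReal.lintegral_mul_le_Lp_mul_Lq (volume.restrict (Icc (-1 : ℝ) 1)) (p := 2) (q := 2)
    (by constructor <;> norm_num) (measurable_hat f).enorm.aemeasurable
    (measurable_const (a := (1 : ℝ≥0∞))).aemeasurable
  simp only [Pi.mul_apply, mul_one, lintegral_one, ENNReal.rpow_two, one_pow,
    Measure.restrict_apply_univ, Real.volume_Icc] at h4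
  have h5 : ∫⁻ ξ in Icc (-1 : ℝ) 1, ‖hat f ξ‖ₑ ^ 2 ≤
      ENNReal.ofReal (2 * Real.pi) * hsNorm s f ^ 2 := by
    rw [← lintegral_weight_eq]
    refine (setLIntegral_le_lintegral _ _).trans (lintegral_mono fun ξ => ?_)
    refine le_mul_of_one_le_left zero_le ?_
    rw [ENNReal.one_le_ofReal]
    exact Real.one_le_rpow (by nlinarith [sq_nonneg ξ]) hs
  refine h3.trans (h4.trans ?_)
  have e2 : ENNReal.ofReal (1 - -1) = 2 := by norm_num
  rw [e2, ← ENNReal.mul_rpow_of_nonneg _ _ (by norm_num)]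
  calc _ ≤ (ENNReal.ofReal (2 * Real.pi) * hsNorm s f ^ 2 * 2) ^ (1 / 2 : ℝ) := by gcongr
    _ = (ENNReal.ofReal (2 * Real.pi) * 2 * hsNorm s f ^ 2) ^ (1 / 2 : ℝ) := by ring_nf
    _ = _ := by
      rw [ENNReal.mul_rpow_of_nonneg _ _ (by norm_num), ← ENNReal.rpow_two (hsNorm s f),
        ← ENNReal.rpow_mul]
      norm_num

theorem enorm_sol_le {s x t : ℝ} (hs : 0 ≤ s) (ht : |t| ≤ 1) :
    ‖sol m f (curve θ κ x t) t‖ₑ ≤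
      (ENNReal.ofReal (2 * Real.pi) * 2) ^ (1 / 2 : ℝ) * hsNorm s f +
        ∑' n, blockSup m θ κ f n x := by
  rcases eq_or_ne (∑' n, blockSup m θ κ f n x) ∞ with h | h
  · rw [h, add_top]; exact le_top
  have h1 := (tendsto_partialSol_sol ht h).2 0
  simp only [pow_zero, zero_add] at h1
  rw [edist_comm, edist_eq_enorm_sub] at h1
  calc ‖sol m f (curve θ κ x t) t‖ₑ
      = ‖partialSol m f 1 (curve θ κ x t) t + (sol m f (curve θ κ x t) t -
          partialSol m f 1 (curve θ κ x t) t)‖ₑ := by rw [add_sub_cancel]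
    _ ≤ _ := (enorm_add_le _ _).trans (add_le_add (enorm_partialSol_one_le hs _ _) h1)

theorem exists_maximalNorm_le {α q s : ℝ} (hm : m ∈ Ioo (0 : ℝ) 1) (hκ : 1 ≤ κ) (hθ : 0 < θ)
    (hα : 0 < α) (hq : 2 ≤ q) (hs1 : 1 / 2 - m / 4 < s) (hs2 : 1 / 2 - m * α / q < s) (A : ℝ≥0) :
    ∃ C : ℝ≥0, ∀ μ : Measure ℝ, IsAlphaDim α A μ →
      ∀ f : Lp ℂ 2 (volume : Measure ℝ), MemHs s f →
        (∀ᵐ x ∂μ, ∀ t ∈ Ioo (0 : ℝ) 1, SolExists m f (curve θ κ x t) t) ∧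
        maximalNorm m θ κ q μ f ≤ C * hsNorm s f := by
  obtain ⟨hm0, hm1⟩ := hm
  have hs : 0 ≤ s := by linarith
  have hq0 : 0 < q := by linarith
  -- The two lower bounds on `s` are what makes this interval nonempty: `b > (1-2s)/m` gives
  -- geometric decay, and `b < 2α/q` makes the potential of exponent `bq/2` finite.
  obtain ⟨b, hb1, hb2⟩ : ∃ b, max 0 ((1 - 2 * s) / m) < b ∧ b < min (1 / 2) (2 * α / q) := by
    refine exists_between (max_lt (lt_min (by norm_num) (by positivity)) (lt_min ?_ ?_))
    · rw [div_lt_iff₀ hm0]; linarith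
    · rw [div_lt_iff₀ hm0]
      have : 2 * α / q * m = 2 * (m * α / q) := by ring
      linarith
  have hb0 : 0 < b := (le_max_left _ _).trans_lt hb1
  have hb : b ≤ 1 / 2 := (hb2.trans_le (min_le_left _ _)).le
  have hbq : b * q / 2 < α := by
    have := hb2.trans_le (min_le_right _ _)
    rw [lt_div_iff₀ hq0] at this
    linarith
  have hbs : 1 - m * b - 2 * s < 0 := by
    have := (le_max_right _ _).trans_lt hb1
    rw [div_lt_iff₀ hm0] at this
    linarith
  set T : ℝ≥0 := A * (2 ^ α : ℝ).toNNReal with hT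
  obtain ⟨V, hV⟩ := exists_lintegral_potential_le (α := α) (β := b * q / 2) (by positivity) hbq A T
  obtain ⟨C, hC⟩ := exists_lintegral_tsum_blockSup_rpow_le (θ := θ) ⟨hm0, hm1⟩ hκ hθ hb0 hb hq hs
    hbs V
  set c0 : ℝ≥0∞ := (ENNReal.ofReal (2 * Real.pi) * 2) ^ (1 / 2 : ℝ) with hc0
  have hc0t : c0 ≠ ∞ := ENNReal.rpow_ne_top_of_nonneg (by norm_num)
    (ENNReal.mul_ne_top ENNReal.ofReal_ne_top (by norm_num))
  set D : ℝ≥0∞ := c0 * (T : ℝ≥0∞) ^ (1 / q) + (C : ℝ≥0∞) ^ (1 / q) with hD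
  have hDt : D ≠ ∞ := ENNReal.add_ne_top.2 ⟨ENNReal.mul_ne_top hc0t
    (ENNReal.rpow_ne_top_of_nonneg (by positivity) ENNReal.coe_ne_top),
    ENNReal.rpow_ne_top_of_nonneg (by positivity) ENNReal.coe_ne_top⟩
  refine ⟨D.toNNReal, fun μ hμ f hf => ?_⟩
  rw [ENNReal.coe_toNNReal hDt]
  have hH := hsNorm_ne_top hs hf
  have huniv : μ univ ≤ T := by
    have hsub : (univ : Set ℝ) ⊆ Metric.ball 0 2 ∪ (Metric.closedBall 0 1)ᶜ := by
      intro x _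
      rcases le_or_gt (dist x 0) 1 with h | h
      · exact Or.inl (h.trans_lt (by norm_num))
      · exact Or.inr (not_le.2 h)
    calc μ univ ≤ μ (Metric.ball 0 2) + μ (Metric.closedBall 0 1)ᶜ :=
          (measure_mono hsub).trans (measure_union_le _ _)
      _ ≤ A * ENNReal.ofReal (2 ^ α) + 0 := add_le_add (hμ.2 0 2 (by norm_num)) hμ.1.le
      _ = T := by rw [add_zero, hT, ENNReal.coe_mul, ENNReal.ofReal]
  have hμf : IsFiniteMeasure μ := ⟨huniv.trans_lt ENNReal.coe_lt_top⟩
  have hbound := hC f μ hμf (hV μ hμ.2 huniv)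
  have hmeas : Measurable fun x => ∑' n, blockSup m θ κ f n x :=
    Measurable.tsum fun n => measurable_blockSup hm0 hκ f n
  constructor
  · have hfin := ae_lt_top (hmeas.pow_const q) (ne_top_of_le_ne_top (ENNReal.mul_ne_top
      ENNReal.coe_ne_top (ENNReal.rpow_ne_top_of_nonneg hq0.le hH)) hbound)
    filter_upwards [hfin] with x hx t ht
    have hx' : ∑' n, blockSup m θ κ f n x ≠ ∞ := fun h => by
      rw [h, ENNReal.top_rpow_of_pos hq0] at hx
      exact lt_irrefl _ hx
    have ht1 : |t| ≤ 1 := abs_le.2 ⟨by linarith [ht.1], ht.2.le⟩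
    exact ⟨_, (tendsto_partialSol_sol ht1 hx').1⟩
  · have hpt : ∀ x, eLpNorm (fun t => sol m f (curve θ κ x t) t) ∞
        (volume.restrict (Ioo (0 : ℝ) 1)) ≤ c0 * hsNorm s f + ∑' n, blockSup m θ κ f n x := by
      intro x
      rw [eLpNorm_exponent_top]
      refine essSup_le_of_ae_le _ ?_
      filter_upwards [ae_restrict_mem measurableSet_Ioo] with t ht
      exact enorm_sol_le hs (abs_le.2 ⟨by linarith [ht.1], ht.2.le⟩)
    calc maximalNorm m θ κ q μ f
        ≤ (∫⁻ x, ((fun _ : ℝ => c0 * hsNorm s f) +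
            (fun x : ℝ => ∑' n, blockSup m θ κ f n x) : ℝ → ℝ≥0∞) x ^ q ∂μ) ^
            (1 / q) := by
          unfold maximalNorm
          gcongr with x
          exact hpt x
      _ ≤ (∫⁻ _, (c0 * hsNorm s f) ^ q ∂μ) ^ (1 / q) +
            (∫⁻ x, (∑' n, blockSup m θ κ f n x) ^ q ∂μ) ^ (1 / q) :=
          ENNReal.lintegral_Lp_add_le measurable_const.aemeasurable hmeas.aemeasurable
            (by linarith)
      _ ≤ ((c0 * hsNorm s f) ^ q * T) ^ (1 / q) + (C * hsNorm s f ^ q) ^ (1 / q) := by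
          rw [lintegral_const]
          gcongr
      _ = D * hsNorm s f := by
          rw [ENNReal.mul_rpow_of_nonneg _ _ (by positivity : 0 ≤ 1 / q),
            ENNReal.mul_rpow_of_nonneg _ _ (by positivity : 0 ≤ 1 / q), ← ENNReal.rpow_mul,
            ← ENNReal.rpow_mul, mul_one_div_cancel hq0.ne', ENNReal.rpow_one, ENNReal.rpow_one, hD]
          ring

/-! ### Hausdorff dimension of the divergence set -/

theorem tsum_ne_top_of_tail {a : ℕ → ℝ≥0∞} (N : ℕ) (h : ∀ n, a n ≠ ∞)
    (ht : ∑' n, a (n + N) ≠ ∞) : ∑' n, a n ≠ ∞ := by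
  induction N with
  | zero => simpa using ht
  | succ N ih =>
    refine ih ?_
    rw [tsum_eq_zero_add' ENNReal.summable]
    refine ENNReal.add_ne_top.2 ⟨h _, ?_⟩
    simpa only [add_assoc, add_comm 1 N] using ht

/-- A ball with `2^(-k-1) < r ≤ 2^(-k)` meets at most three dyadic intervals of length `2^(-k)`,
each of mass at most `2^α r^α ≤ 2 r^α`; hence the constant 6. -/
theorem measure_ball_le_of_cell_le {α : ℝ} (hα0 : 0 < α) (hα1 : α ≤ 1) {μ : Measure ℝ}
    (hμ : ∀ k l, μ (cell k l) ≤ ENNReal.ofReal (2 ^ (-α)) ^ k) (huniv : μ univ ≤ 1) (x r : ℝ)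
    (hr : 0 < r) : μ (Metric.ball x r) ≤ (6 : ℝ≥0) * ENNReal.ofReal (r ^ α) := by
  rcases le_or_gt r 1 with h1 | h1
  · obtain ⟨k, hk1, hk2⟩ := exists_nat_pow_near_of_lt_one hr h1 (by norm_num : (0 : ℝ) < 1 / 2)
      (by norm_num)
    set i := ⌊2 ^ k * x⌋ with hi
    have hsub : Metric.ball x r ⊆ cell k (i - 1) ∪ (cell k i ∪ cell k (i + 1)) := by
      intro y hy
      rw [Metric.mem_ball, Real.dist_eq, abs_lt] at hy
      have h2 : (0 : ℝ) < 2 ^ k := by positivity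
      have h3 : 2 ^ k * r ≤ 1 := by
        calc 2 ^ k * r ≤ 2 ^ k * (1 / 2) ^ k := by gcongr
          _ = 1 := by rw [← mul_pow]; norm_num
      have h4 := mul_lt_mul_of_pos_left hy.1 h2
      have h5 := mul_lt_mul_of_pos_left hy.2 h2
      have h6 := Int.floor_le (2 ^ k * x)
      have h7 := Int.lt_floor_add_one (2 ^ k * x)
      have h8 := Int.floor_le (2 ^ k * y)
      have h9 := Int.lt_floor_add_one (2 ^ k * y)
      rw [← hi] at h6 h7
      have h10 : (⌊2 ^ k * y⌋ : ℝ) < i + 2 := by nlinarith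
      have h11 : (i : ℝ) - 2 < ⌊2 ^ k * y⌋ := by nlinarith
      have h12 : ⌊2 ^ k * y⌋ < i + 2 := by exact_mod_cast h10
      have h13 : i - 2 < ⌊2 ^ k * y⌋ := by exact_mod_cast h11
      simp only [mem_union, mem_cell]
      omega
    have hw : ENNReal.ofReal (2 ^ (-α)) ^ k ≤ 2 * ENNReal.ofReal (r ^ α) := by
      have e : (2 : ℝ≥0∞) = ENNReal.ofReal 2 := by norm_num
      rw [← ENNReal.ofReal_pow (by positivity), e, ← ENNReal.ofReal_mul (by norm_num)]
      refine ENNReal.ofReal_le_ofReal ?_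
      calc ((2 : ℝ) ^ (-α)) ^ k = 2 ^ α * ((1 / 2) ^ (k + 1)) ^ α := by
            rw [one_div, inv_pow, Real.inv_rpow (by positivity), ← Real.rpow_natCast,
              ← Real.rpow_natCast, ← Real.rpow_mul (by norm_num), ← Real.rpow_mul (by norm_num),
              ← Real.rpow_neg (by norm_num), ← Real.rpow_add (by norm_num)]
            push_cast
            ring_nf
        _ ≤ 2 * r ^ α := by
            gcongr
            exact (Real.rpow_le_rpow_of_exponent_le (by norm_num) hα1).trans (by simp)
    calc μ (Metric.ball x r) ≤ μ (cell k (i - 1)) + (μ (cell k i) + μ (cell k (i + 1))) :=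
          (measure_mono hsub).trans ((measure_union_le _ _).trans
            (add_le_add le_rfl (measure_union_le _ _)))
      _ ≤ 2 * ENNReal.ofReal (r ^ α) + (2 * ENNReal.ofReal (r ^ α) + 2 * ENNReal.ofReal (r ^ α)) :=
          add_le_add ((hμ _ _).trans hw) (add_le_add ((hμ _ _).trans hw) ((hμ _ _).trans hw))
      _ = (6 : ℝ≥0) * ENNReal.ofReal (r ^ α) := by push_cast; ring
  · refine (measure_mono (subset_univ _)).trans (huniv.trans ?_)
    have : (1 : ℝ≥0∞) ≤ ENNReal.ofReal (r ^ α) := by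
      rw [ENNReal.one_le_ofReal]; exact Real.one_le_rpow h1.le hα0.le
    calc (1 : ℝ≥0∞) ≤ (6 : ℝ≥0) * 1 := by norm_num
      _ ≤ _ := by gcongr

/-- Uniform continuity over the compact parameter set. It is needed because the discrete Frostman
measure lives on intervals meeting a superlevel set, not on the set itself. -/
theorem exists_blockSup_le_add (hm : 0 < m) (hκ : 1 ≤ κ) (f : Lp ℂ 2 (volume : Measure ℝ)) (n : ℕ)
    (i : ℤ) {a : ℝ≥0∞} (ha : 0 < a) :
    ∃ J : ℕ, ∀ x ∈ cell 0 i, ∀ y, ⌊2 ^ J * y⌋ = ⌊2 ^ J * x⌋ →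
      blockSup m θ κ f n x ≤ blockSup m θ κ f n y + a := by
  have hc : Continuous fun z : Icc (i : ℝ) (i + 1) × BlockParams n =>
      increment m θ κ f n z.1 z.2 :=
    (continuous_increment hm hκ f n).comp
      (by fun_prop : Continuous fun z : Icc (i : ℝ) (i + 1) × BlockParams n => ((z.1 : ℝ), z.2))
  have hu := CompactSpace.uniformContinuous_of_continuous hc
  rw [EMetric.uniformContinuous_iff] at hu
  obtain ⟨δ, hδ, h⟩ := hu a ha
  have hlim : Tendsto (fun J : ℕ => ((1 : ℝ≥0∞) / 2) ^ J) atTop (𝓝 0) :=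
    ENNReal.tendsto_pow_atTop_nhds_zero_of_lt_one (by simp)
  obtain ⟨J, hJ⟩ := (hlim.eventually (eventually_lt_nhds hδ)).exists
  refine ⟨J, fun x hx y hxy => iSup_le fun p => ?_⟩
  have hy : y ∈ cell 0 i := by
    rw [mem_cell, floor_two_pow_congr (Nat.zero_le J) hxy]; exact hx
  have hI : ∀ {z}, z ∈ cell 0 i → z ∈ Icc (i : ℝ) (i + 1) := fun {z} hz => by
    rw [cell_eq_Ico, pow_zero, div_one, div_one] at hz
    exact Ico_subset_Icc_self hz
  have hd : edist x y < δ :=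
    ((Metric.edist_le_ediam_of_mem (mem_cell.2 hxy.symm) (mem_cell.2 rfl)).trans
      (ediam_cell_le J _)).trans_lt hJ
  have h2 := h (a := (⟨x, hI hx⟩, p)) (b := (⟨y, hI hy⟩, p)) (by
    rw [Prod.edist_eq, edist_self, max_eq_left zero_le]
    exact hd)
  rw [edist_eq_enorm_sub] at h2
  calc ‖increment m θ κ f n x p‖ₑ
      = ‖increment m θ κ f n y p + (increment m θ κ f n x p - increment m θ κ f n y p)‖ₑ := by
        rw [add_sub_cancel]
    _ ≤ _ := (enorm_add_le _ _).trans (add_le_add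
        (le_iSup (fun p : BlockParams n => ‖increment m θ κ f n y p‖ₑ) p) h2.le)

/-- A covering of the set where the maximal function of a block is large. -/
theorem exists_cover_blockSup {b α : ℝ} (hm : m ∈ Ioo (0 : ℝ) 1) (hκ : 1 ≤ κ) (hθ : 0 < θ)
    (hb0 : 0 < b) (hb : b ≤ 1 / 2) (hbα : b < α) (hα : α ≤ 1) :
    ∃ C : ℝ≥0, ∀ (s : ℝ) (f : Lp ℂ 2 (volume : Measure ℝ)) (n : ℕ) (i : ℤ) (a : ℝ≥0∞), 0 ≤ s →
      0 < a → a ≠ ∞ → ∃ 𝒞 : Finset (ℕ × ℤ),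
        cell 0 i ∩ {x | 2 * a < blockSup m θ κ f n x} ⊆ ⋃ p ∈ 𝒞, cell p.1 p.2 ∧
        a ^ 2 * ∑ p ∈ 𝒞, ENNReal.ofReal (2 ^ (-α)) ^ p.1 ≤
          C * ENNReal.ofReal ((2 ^ (1 - m * b - 2 * s)) ^ n) * hsNorm s f ^ 2 := by
  have hα0 : 0 < α := hb0.trans hbα
  obtain ⟨V, hV⟩ := exists_lintegral_potential_le hb0 hbα 6 1
  obtain ⟨C, hC⟩ := exists_lintegral_blockSup_sq_le (θ := θ) hm hκ hθ hb0 hb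
  refine ⟨C * V, fun s f n i a hs ha hat => ?_⟩
  set w : ℝ≥0∞ := ENNReal.ofReal (2 ^ (-α)) with hw
  have hw1 : w ≤ 1 := by
    rw [hw, ENNReal.ofReal_le_one]
    exact Real.rpow_le_one_of_one_le_of_nonpos (by norm_num) (by linarith)
  have hw2 : 1 / 2 ≤ w := by
    have e : (1 / 2 : ℝ≥0∞) = ENNReal.ofReal (2 ^ (-1 : ℝ)) := by
      rw [Real.rpow_neg_one, ENNReal.ofReal_inv_of_pos (by norm_num), one_div]
      norm_num
    rw [e, hw]
    exact ENNReal.ofReal_le_ofReal (Real.rpow_le_rpow_of_exponent_le (by norm_num) (by linarith))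
  obtain ⟨J, hJ⟩ := exists_blockSup_le_add (θ := θ) (κ := κ) hm.1 hκ f n i ha
  obtain ⟨μ, 𝒞, hμs, hμb, hμU, hcov, hmass⟩ := exists_dyadic_frostman hw1 hw2
    {x | 2 * a < blockSup m θ κ f n x} J 0 i
  refine ⟨𝒞, hcov, ?_⟩
  have huniv : μ univ ≤ 1 := by
    rw [← measure_add_measure_compl (measurableSet_cell 0 i), hμs, add_zero, ← pow_zero w]
    exact hμb _ _
  have hfin : IsFiniteMeasure μ := ⟨huniv.trans_lt ENNReal.one_lt_top⟩
  have hpot := hV μ (measure_ball_le_of_cell_le hα0 hα hμb huniv) (by simpa using huniv)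
  -- Moving from a point of the superlevel set to `y` in the same small interval loses at most `a`
  -- out of `2a`.
  have hlow : ∀ᵐ y ∂μ, a ≤ blockSup m θ κ f n y := by
    filter_upwards [hμU] with y ⟨x, hx, hxy⟩
    rw [zero_add] at hxy
    have h1 : a + a < blockSup m θ κ f n y + a := by
      rw [← two_mul]
      exact lt_of_lt_of_le hx.2 (hJ x hx.1 y hxy)
    exact ((ENNReal.add_lt_add_iff_right hat).1 h1).le
  -- Chebyshev's inequality for the Frostman measure, whose mass dominates the cost of the cover.
  calc a ^ 2 * ∑ p ∈ 𝒞, w ^ p.1 ≤ a ^ 2 * μ univ := by gcongr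
    _ = ∫⁻ _, a ^ 2 ∂μ := by rw [lintegral_const]
    _ ≤ ∫⁻ y, blockSup m θ κ f n y ^ 2 ∂μ := by
        refine lintegral_mono_ae ?_
        filter_upwards [hlow] with y hy
        gcongr
    _ ≤ C * V * ENNReal.ofReal ((2 ^ (1 - m * b - 2 * s)) ^ n) * hsNorm s f ^ 2 :=
        hC s f n μ V hs hfin hpot
    _ = _ := by push_cast; rfl

/-- A Borel–Cantelli argument: a point with `M_n ≤ 2w^n` for all large `n` is a point of
convergence, while the covers of `{M_n > 2w^n}` have total `α`-cost with vanishing tails. -/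
theorem hausdorffMeasure_divergenceSet_inter_cell {b s : ℝ} {α : ℝ≥0} (hm : m ∈ Ioo (0 : ℝ) 1)
    (hκ : 1 ≤ κ) (hθ : 0 < θ) (hb0 : 0 < b) (hb : b ≤ 1 / 2) (hbα : b < α) (hα : α ≤ 1)
    (hs : 0 ≤ s) (hbs : 1 - m * b - 2 * s < 0) (hf : MemHs s f) (i : ℤ) :
    μH[α] (divergenceSet m θ κ f ∩ cell 0 i) = 0 := by
  have hH := hsNorm_ne_top hs hf
  have hα0 : (0 : ℝ) < α := hb0.trans hbα
  obtain ⟨C, hC⟩ := exists_cover_blockSup (θ := θ) hm hκ hθ hb0 hb hbα (by exact_mod_cast hα)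
  -- The block bound is of order `σ^(4n)`; dividing by the squared threshold `σ^(2n)` leaves a
  -- summable cost.
  set σ : ℝ := 2 ^ ((1 - m * b - 2 * s) / 4) with hσ
  have hσ0 : 0 < σ := by positivity
  have hσ1 : σ < 1 := Real.rpow_lt_one_of_one_lt_of_neg (by norm_num) (by linarith)
  have hσ4 : (2 : ℝ) ^ (1 - m * b - 2 * s) = σ ^ 4 := by
    rw [hσ, ← Real.rpow_natCast, ← Real.rpow_mul (by norm_num)]
    congr 1
    push_cast
    ring
  set w : ℝ≥0∞ := ENNReal.ofReal σ with hw
  have hw0 : w ≠ 0 := by rw [hw, Ne, ENNReal.ofReal_eq_zero, not_le]; exact hσ0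
  have hwt : w ≠ ∞ := ENNReal.ofReal_ne_top
  have hw1 : w < 1 := by rwa [hw, ENNReal.ofReal_lt_one]
  have hG : (1 - w)⁻¹ ≠ ∞ := ENNReal.inv_ne_top.2 (tsub_pos_of_lt hw1).ne'
  set v : ℝ≥0∞ := ENNReal.ofReal (2 ^ (-(α : ℝ))) with hv
  set K : ℝ≥0∞ := C * hsNorm s f ^ 2 with hK
  have hKt : K ≠ ∞ := ENNReal.mul_ne_top ENNReal.coe_ne_top (ENNReal.pow_ne_top hH)
  have hcov : ∀ n : ℕ, ∃ 𝒞 : Finset (ℕ × ℤ),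
      cell 0 i ∩ {x | 2 * w ^ n < blockSup m θ κ f n x} ⊆ ⋃ p ∈ 𝒞, cell p.1 p.2 ∧
      ∑ p ∈ 𝒞, v ^ p.1 ≤ K * w ^ n := by
    intro n
    have hwn0 : w ^ n ≠ 0 := pow_ne_zero n hw0
    have hwnt : w ^ n ≠ ∞ := ENNReal.pow_ne_top hwt
    obtain ⟨𝒞, h1, h2⟩ := hC s f n i (w ^ n) hs (pos_iff_ne_zero.2 hwn0) hwnt
    refine ⟨𝒞, h1, ?_⟩
    have e1 : ENNReal.ofReal ((2 ^ (1 - m * b - 2 * s)) ^ n) = (w ^ n) ^ 2 * (w ^ n) ^ 2 := by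
      rw [hσ4, ENNReal.ofReal_pow (by positivity), ENNReal.ofReal_pow hσ0.le, hw]
      ring
    have h3 : (w ^ n) ^ 2 * ∑ p ∈ 𝒞, v ^ p.1 ≤ (w ^ n) ^ 2 * (K * w ^ n) := by
      refine h2.trans ?_
      rw [e1]
      calc C * ((w ^ n) ^ 2 * (w ^ n) ^ 2) * hsNorm s f ^ 2
          = (w ^ n) ^ 2 * (K * (w ^ n * w ^ n)) := by rw [hK]; ring
        _ ≤ (w ^ n) ^ 2 * (K * (w ^ n * 1)) := by
            gcongr
            exact pow_le_one' hw1.le n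
        _ = _ := by rw [mul_one]
    exact (ENNReal.mul_le_mul_iff_right (pow_ne_zero 2 hwn0) (ENNReal.pow_ne_top hwnt)).1 h3
  choose 𝒞 hsub hsum using hcov
  set T : ℕ → ℝ≥0∞ := fun N => K * (w ^ N * (1 - w)⁻¹) with hT
  have htail : ∀ N, ∑' n, ∑ p ∈ 𝒞 (n + N), v ^ p.1 ≤ T N := by
    intro N
    calc ∑' n, ∑ p ∈ 𝒞 (n + N), v ^ p.1 ≤ ∑' n, K * w ^ (n + N) :=
          ENNReal.tsum_le_tsum fun n => hsum (n + N)
      _ = T N := by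
          simp_rw [pow_add]
          rw [ENNReal.tsum_mul_left, ENNReal.tsum_mul_right, ENNReal.tsum_geometric, hT]
          ring
  have hT0 : Tendsto T atTop (𝓝 0) := by
    have h1 := ENNReal.tendsto_pow_atTop_nhds_zero_of_lt_one hw1
    have h2 := ENNReal.Tendsto.mul_const h1 (Or.inr hG)
    have h3 := ENNReal.Tendsto.const_mul (a := K) h2 (Or.inr hKt)
    simpa using h3
  have hT0' : Tendsto (fun N => T N ^ (1 / (α : ℝ))) atTop (𝓝 0) := by
    have := ((ENNReal.continuous_rpow_const (y := 1 / (α : ℝ))).tendsto 0).comp hT0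
    rwa [ENNReal.zero_rpow_of_pos (by positivity)] at this
  have hdiam : ∀ p : ℕ × ℤ, Metric.ediam (cell p.1 p.2) ^ (α : ℝ) ≤ v ^ p.1 := by
    intro p
    refine (ENNReal.rpow_le_rpow (ediam_cell_le p.1 p.2) hα0.le).trans (le_of_eq ?_)
    have e : (1 / 2 : ℝ≥0∞) = ENNReal.ofReal (1 / 2) := by
      rw [ENNReal.ofReal_div_of_pos (by norm_num)]; norm_num
    rw [e, hv, ← ENNReal.ofReal_pow (by norm_num), ← ENNReal.ofReal_pow (by positivity),
      ENNReal.ofReal_rpow_of_pos (by positivity)]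
    congr 1
    rw [one_div, inv_pow, Real.inv_rpow (by positivity), ← Real.rpow_natCast, ← Real.rpow_natCast,
      ← Real.rpow_mul (by norm_num), ← Real.rpow_mul (by norm_num), ← Real.rpow_neg (by norm_num)]
    ring_nf
  have key := Measure.hausdorffMeasure_le_liminf_tsum
    (ι := fun N : ℕ => Σ n : ℕ, {p : ℕ × ℤ // p ∈ 𝒞 (n + N)}) (α : ℝ)
    (divergenceSet m θ κ f ∩ cell 0 i) (l := atTop) (fun N => T N ^ (1 / (α : ℝ))) hT0'
    (fun N p => cell p.2.1.1 p.2.1.2) (Eventually.of_forall fun N p => ?_)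
    (Eventually.of_forall fun N x hx => ?_)
  · refine le_antisymm (key.trans ?_) zero_le
    rw [← hT0.liminf_eq]
    refine liminf_le_liminf (Eventually.of_forall fun N => ?_)
    refine le_trans ?_ (htail N)
    rw [ENNReal.tsum_sigma']
    refine ENNReal.tsum_le_tsum fun n => ?_
    have e := Finset.tsum_subtype (𝒞 (n + N)) fun p : ℕ × ℤ => v ^ p.1
    refine le_trans ?_ e.le
    exact ENNReal.tsum_le_tsum fun p => hdiam p.1
  -- Each `α`-cost in the cover is at most the total cost, so the diameters also tend to zero
  -- uniformly.
  · rw [one_div, ENNReal.le_rpow_inv_iff hα0]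
    refine (hdiam p.2.1).trans (le_trans ?_ (htail N))
    refine le_trans ?_ (ENNReal.le_tsum p.1)
    have h5 : ∀ q ∈ 𝒞 (p.1 + N), v ^ q.1 ≤ ∑ p ∈ 𝒞 (p.1 + N), v ^ p.1 := fun q hq =>
      Finset.single_le_sum (f := fun p : ℕ × ℤ => v ^ p.1) (fun _ _ => zero_le) hq
    exact h5 p.2.1 p.2.2
  · by_contra hnot
    have hle : ∀ n, blockSup m θ κ f (n + N) x ≤ 2 * w ^ (n + N) := by
      intro n
      by_contra hlt
      obtain ⟨p, hp, hxp⟩ := mem_iUnion₂.1 (hsub (n + N) ⟨hx.2, not_le.1 hlt⟩)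
      exact hnot (mem_iUnion.2 ⟨⟨n, p, hp⟩, hxp⟩)
    refine hx.1 (solExists_zero_and_convergesAlong hm.1 hκ ?_)
    refine tsum_ne_top_of_tail N (fun n => ?_) ?_
    · obtain ⟨R, hR, hMR⟩ := exists_blockSup_le (θ := θ) (κ := κ) hm.1 f n
      exact ne_top_of_le_ne_top hR (hMR x)
    · refine ne_top_of_le_ne_top ?_ (ENNReal.tsum_le_tsum hle)
      simp_rw [pow_add]
      rw [ENNReal.tsum_mul_left, ENNReal.tsum_mul_right, ENNReal.tsum_geometric]
      exact ENNReal.mul_ne_top (by norm_num) (ENNReal.mul_ne_top hG (ENNReal.pow_ne_top hwt))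

theorem dimH_divergenceSet_le {s : ℝ} (hm : m ∈ Ioo (0 : ℝ) 1) (hκ : 1 ≤ κ) (hθ : 0 < θ)
    (hs1 : 1 / 2 - m / 4 < s) (hs2 : s < 1 / 2) (hf : MemHs s f) :
    dimH (divergenceSet m θ κ f) ≤ ENNReal.ofReal ((1 - 2 * s) / m) := by
  obtain ⟨hm0, hm1⟩ := hm
  have hs : 0 ≤ s := by linarith
  set α₀ := (1 - 2 * s) / m with hα₀
  have hα₀0 : 0 < α₀ := div_pos (by linarith) hm0
  have hα₀1 : α₀ < 1 / 2 := by rw [hα₀, div_lt_iff₀ hm0]; linarith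
  by_contra hlt
  obtain ⟨β, hβ1, hβ2⟩ := ENNReal.lt_iff_exists_nnreal_btwn.1 (not_le.1 hlt)
  have hβ : α₀ < β := (ENNReal.ofReal_lt_iff_lt_toReal hα₀0.le ENNReal.coe_ne_top).1 hβ1
  -- Here `b > (1-2s)/m` gives decay of the blocks, and `b < β` makes potentials of `β`-dimensional
  -- measures finite. Dimensions above 1 are replaced by 1, as the Frostman construction requires.
  obtain ⟨b, hb1, hb2⟩ := exists_between (lt_min hβ hα₀1)
  have hbβ : b < (min β 1 : ℝ≥0) := by
    rw [NNReal.coe_min]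
    exact lt_min (hb2.trans_le (min_le_left _ _))
      ((hb2.trans_le (min_le_right _ _)).trans (by norm_num))
  have hbs : 1 - m * b - 2 * s < 0 := by
    rw [hα₀, div_lt_iff₀ hm0] at hb1
    linarith
  have hcell := fun i => hausdorffMeasure_divergenceSet_inter_cell (f := f) (α := min β 1)
    ⟨hm0, hm1⟩ hκ hθ (hα₀0.trans hb1) (hb2.trans_le (min_le_right _ _)).le hbβ (min_le_right _ _)
    hs hbs hf i
  have hun : divergenceSet m θ κ f = ⋃ i : ℤ, divergenceSet m θ κ f ∩ cell 0 i := by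
    rw [← inter_iUnion]
    refine (inter_eq_left.2 fun x _ => ?_).symm
    exact mem_iUnion.2 ⟨_, mem_cell.2 rfl⟩
  have hdim : dimH (divergenceSet m θ κ f) ≤ β := by
    rw [hun, dimH_iUnion]
    refine iSup_le fun i => ?_
    refine (dimH_le_of_hausdorffMeasure_ne_top (d := min β 1) ?_).trans
      (ENNReal.coe_le_coe.2 (min_le_left _ _))
    rw [hcell i]
    exact ENNReal.zero_ne_top
  exact absurd hβ2 (not_lt.2 hdim)

end FracSchrodinger

end

/-! ### The theorem -/

theorem theorem2 (m κ θ : ℝ) (hm : m ∈ Set.Ioo (0 : ℝ) 1) (hκ : 1 ≤ κ) (hθ : 0 < θ) :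
    (∀ s : ℝ, 1 / 2 - m / 4 < s →
      ∀ f : Lp ℂ 2 (volume : Measure ℝ), FracSchrodinger.MemHs s f →
        ∀ᵐ x : ℝ, FracSchrodinger.ConvergesAlong m θ κ f x (f x)) ∧
    (∀ s : ℝ, s ∈ Set.Ioo (1 / 2 - m / 4) (1 / 2) →
      ∀ f : Lp ℂ 2 (volume : Measure ℝ), FracSchrodinger.MemHs s f →
        dimH (FracSchrodinger.divergenceSet m θ κ f) ≤ ENNReal.ofReal ((1 - 2 * s) / m)) ∧
    (∀ α : ℝ, α ∈ Set.Ioc (0 : ℝ) 1 → ∀ q : ℝ, 2 ≤ q →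
      ∀ s : ℝ, max (1 / 2 - m / 4) (1 / 2 - m * α / q) < s →
      ∀ A : ℝ≥0, ∃ C : ℝ≥0, ∀ μ : Measure ℝ, FracSchrodinger.IsAlphaDim α A μ →
      ∀ f : Lp ℂ 2 (volume : Measure ℝ), FracSchrodinger.MemHs s f →
        (∀ᵐ x ∂μ, ∀ t ∈ Set.Ioo (0 : ℝ) 1,
          FracSchrodinger.SolExists m f (FracSchrodinger.curve θ κ x t) t) ∧
        FracSchrodinger.maximalNorm m θ κ q μ f ≤ C * FracSchrodinger.hsNorm s f) := by
  exact ⟨fun s hs f hf => FracSchrodinger.ae_convergesAlong hm hκ hθ hs hf,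
    fun s hs f hf => FracSchrodinger.dimH_divergenceSet_le hm hκ hθ hs.1 hs.2 hf,
    fun α hα q hq s hs A => FracSchrodinger.exists_maximalNorm_le hm hκ hθ hα.1 hq
      ((le_max_left _ _).trans_lt hs) ((le_max_right _ _).trans_lt hs) A⟩
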